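/- **Setting.** A chain is a triple $(\mathcal X,K,\pi)$, where $\mathcal X$ is a countable set, $K$ is an irreducible stochastic matrix on $\mathcal X$ and $\pi$ is a probability on $\mathcal X$ with $\pi K=\pi$. The associated continuous time chain has transition matrices $H_t=e^{-t(I-K)}$, $t\ge 0$. Its maximum total variation and maximum Hellinger distance are $$d_{TV}(t)=\sup_{x\in\mathcal X,\,A\subseteq\mathcal X}\{H_t(x,A)-\pi(A)\},\qquad d_H(t)=\sup_{x\in\mathcal X}\Big(\tfrac12\sum_{y\in\mathcal X}\big(\sqrt{H_t(x,y)}-\sqrt{\pi(y)}\big)^2\Big)^{1/2},$$ and for $*\in\{TV,H\}$ its mixing time is $T_*(\epsilon)=\inf\{t\ge0: d_*(t)\le\epsilon\}\in[0,\infty]$. For a family $\mathcal G=(\mathcal X_n,K_n,\pi_n)_{n\ge1}$, let $\mathcal G_c$ be the family of associated continuous time chains and let $d_{n,*},T_{n,*}$ be the distance and mixing time of its $n$th member. $\mathcal G_c$ has a cutoff (with respect to $*$) with cutoff time $(t_n)_{n\ge1}$, $t_n>0$, if $\lim_n d_{n,*}(at_n)=0$ for all $a>1$ and $\lim_n d_{n,*}(at_n)=1$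 for all $0<a<1$; it has a cutoff if it has one with some cutoff time. The product of $(\mathcal X_i,K_i,\pi_i)_{i=1}^n$ according to a probability vector $(w_1,\dots,w_n)$ is the chain on $\mathcal X_1\times\cdots\times\mathcal X_n$ with stationary distribution $\pi_1\times\cdots\times\pi_n$ and transition matrix $\sum_{i=1}^n w_i\, I_1\otimes\cdots\otimes I_{i-1}\otimes K_i\otimes I_{i+1}\otimes\cdots\otimes I_n$. Given a family $\mathcal F=(\mathcal X_n,K_n,\pi_n)_{n\ge1}$ of chains and a sequence $\mathcal P=(p_n)_{n\ge1}$ of positive reals, put $q_n=p_1+\cdots+p_n$ and let $\mathcal F^{\mathcal P}$ be the family whose $n$th member is the product of $(\mathcal X_i,K_i,\pi_i)_{i=1}^n$ according to $(p_1/q_n,\dots,p_n/q_n)$. For a (strictly) increasing sequence $\xi=(\xi_n)_{n\ge1}$ of positive integers let $\mathcal F_\xi=(\mathcal X_{\xi_n},K_{\xi_n},\pi_{\xi_n})_{n\ge1}$, $\mathcal P_\xi=(p_{\xi_n})_{n\ge1}$ and $\mathcal F^{\mathcal P,\xi}=(\mathcal F_\xi)^{\mathcal P_\xi}$. The subfamilies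 of $\mathcal F_c$ are the families $(\mathcal F_\xi)_c$. **Theorem 4.7.** Let $*\in\{TV,H\}$, $\varrho_{TV}=1$, $\varrho_H=2$, and let $T_{n,*}$ be the mixing time of the $n$th chain in $\mathcal F_c$. Assume that there are $c_0\in(0,1)$, $N>0$ and a sequence $(\epsilon_n)_{n\ge1}$ with $0<\inf_n\epsilon_n\le\sup_n\epsilon_n<1/(2\varrho_*)$ such that $$\max_{1\le i\le n}\frac{T_{i,*}(\epsilon_i)}{p_i}=\frac{T_{n,*}(\epsilon_n)}{p_n}\quad\text{for all } n\ge N$$ and $$\lim_{m\to\infty}\limsup_{n\to\infty}\sum_{i=1}^{n-m}\Big(2\varrho_*\sup_{k\ge1}\epsilon_k\Big)^{c_0\varrho_*\,T_{n,*}(\epsilon_n)p_i/(T_{i,*}(\epsilon_i)p_n)}=0 .$$ (If mixing times $0$ or $\infty$ occur, the exponent is read in $[0,\infty]$ with $a/0=\infty$ for $a>0$, $0/0=\infty/\infty=0$, and $b^\infty=0$ for $0<b<1$.) Then, with all cutoffs taken with respect to $*$: 1. $\mathcal F_c$ has a cutoff if and only if $\mathcal F^{\mathcal P,\xi}_c$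 has a cutoff for every increasing sequence $\xi$ of positive integers. In particular, if $\mathcal F_c$ has a cutoff, then $\mathcal F^{\mathcal P}_c$ has a cutoff. 2. No subfamily of $\mathcal F_c$ has a cutoff if and only if, for every increasing sequence $\xi$ of positive integers, $\mathcal F^{\mathcal P,\xi}_c$ has no cutoff. In particular, if no subfamily of $\mathcal F_c$ has a cutoff, then $\mathcal F^{\mathcal P}_c$ has no cutoff. 3. If $(t_n)$ is a cutoff time for $\mathcal F_c$, then $(q_nt_n/p_n)$ is a cutoff time for $\mathcal F^{\mathcal P}_c$. -/

import Mathlib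

open Filter Topology
open scoped ENNReal NNReal

universe u

noncomputable section

namespace ProductCutoff

/-- A triple `(X, K, π)`: a set, a matrix and a vector indexed by it. The laws that make it an
irreducible Markov chain are collected in `MarkovTriple.IsIrreducibleChain`. -/
structure MarkovTriple : Type (u + 1) where
  /-- the state space `X` -/
  State : Type u
  /-- the transition matrix `K` -/
  K : State → State → ℝ
  /-- the stationary distribution `π` -/
  stat : State → ℝ

namespace MarkovTriple

open Classical in
/-- The matrix power `K ^ m`. -/
def iter (M : MarkovTriple.{u}) : ℕ → M.State → M.State → ℝ
  | 0 => fun x y => if x = y then 1 else 0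
  | m + 1 => fun x y => ∑' z, M.iter m x z * M.K z y

/-- `X` is countable, `K` is an irreducible stochastic matrix on `X`, and `π` is a probability
on `X` with `π K = π`. -/
structure IsIrreducibleChain (M : MarkovTriple.{u}) : Prop where
  countable : Countable M.State
  K_nonneg : ∀ x y, 0 ≤ M.K x y
  K_sum : ∀ x, HasSum (fun y => M.K x y) 1
  irreducible : ∀ x y, ∃ m, 0 < M.iter m x y
  stat_nonneg : ∀ x, 0 ≤ M.stat x
  stat_sum : HasSum M.stat 1
  stationary : ∀ y, HasSum (fun x => M.stat x * M.K x y) (M.stat y)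

/-- The transition matrix `H_t = exp (-t (I - K)) = e^{-t} ∑ₘ (t^m / m!) K^m` of the associated
continuous time chain. -/
def heat (M : MarkovTriple.{u}) (t : ℝ) (x y : M.State) : ℝ :=
  ∑' m : ℕ, Real.exp (-t) * (t ^ m / (m.factorial : ℝ)) * M.iter m x y

/-- The maximum total variation of the continuous time chain,
`sup { H_t(x, A) - π(A) : x ∈ X, A ⊆ X }`. -/
def dTV (M : MarkovTriple.{u}) (t : ℝ) : ℝ :=
  ⨆ q : M.State × Set M.State, ((∑' y : q.2, M.heat t q.1 y) - ∑' y : q.2, M.stat y)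

/-- The maximum Hellinger distance of the continuous time chain. -/
def dH (M : MarkovTriple.{u}) (t : ℝ) : ℝ :=
  ⨆ x : M.State, √((1 / 2) * ∑' y, (√(M.heat t x y) - √(M.stat y)) ^ 2)

end MarkovTriple

/-- The two ways of measuring distance to stationarity. -/
inductive Distance
  | totalVariation
  | hellinger

/-- The constant `ϱ` attached to a distance: `1` for total variation, `2` for Hellinger. -/
def Distance.rho : Distance → ℝ
  | .totalVariation => 1
  | .hellinger => 2

/-- The maximum distance to stationarity at time `t` of the continuous time chain. -/
def maxDist : Distance → MarkovTriple.{u} → ℝ → ℝ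
  | .totalVariation, M, t => M.dTV t
  | .hellinger, M, t => M.dH t

/-- The mixing time `T(ε) = inf {t ≥ 0 : d(t) ≤ ε}` of the continuous time chain, with values in
`[0, ∞]` (`inf ∅ = ∞`). -/
def mixingTime (δ : Distance) (M : MarkovTriple.{u}) (ε : ℝ) : ℝ≥0∞ :=
  ⨅ (t : ℝ≥0) (_ : maxDist δ M (t : ℝ) ≤ ε), (t : ℝ≥0∞)

/-- `t` is a cutoff time for the family of continuous time chains associated with `F`. -/
def IsCutoffTime (δ : Distance) (F : ℕ → MarkovTriple.{u}) (t : ℕ → ℝ) : Prop :=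
  (∀ n, 0 < t n) ∧
  (∀ a : ℝ, 1 < a → Tendsto (fun n => maxDist δ (F n) (a * t n)) atTop (𝓝 0)) ∧
  (∀ a : ℝ, 0 < a → a < 1 → Tendsto (fun n => maxDist δ (F n) (a * t n)) atTop (𝓝 1))

/-- The family of continuous time chains associated with `F` has a cutoff. -/
def HasCutoff (δ : Distance) (F : ℕ → MarkovTriple.{u}) : Prop :=
  ∃ t : ℕ → ℝ, IsCutoffTime δ F t

open Classical in
/-- The product chain of `(M i)` according to the vector `w`: the state space is `∏ X_i`, the
stationary distribution is `⊗ π_i`, and the transition matrix is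
`∑ᵢ wᵢ I ⊗ ⋯ ⊗ I ⊗ Kᵢ ⊗ I ⊗ ⋯ ⊗ I`. -/
def productChain {ι : Type} [Fintype ι] (M : ι → MarkovTriple.{u}) (w : ι → ℝ) :
    MarkovTriple.{u} where
  State := ∀ i, (M i).State
  K := fun x y => ∑ i, w i *
    ((M i).K (x i) (y i) * ∏ j ∈ Finset.univ.erase i, if x j = y j then (1 : ℝ) else 0)
  stat := fun x => ∏ i, (M i).stat (x i)

/-- The partial sums `p_0 + ⋯ + p_n`. -/
def partialSum (p : ℕ → ℝ) (n : ℕ) : ℝ := ∑ i ∈ Finset.range (n + 1), p i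

/-- The family of product chains: its `n`-th member is the product of the chains `0, …, n` of `F`
according to the probability vector `(p_0 / q_n, …, p_n / q_n)`, where `q_n = p_0 + ⋯ + p_n`. -/
def productFamily (F : ℕ → MarkovTriple.{u}) (p : ℕ → ℝ) (n : ℕ) : MarkovTriple.{u} :=
  productChain (fun i : Fin (n + 1) => F i) (fun i : Fin (n + 1) => p i / partialSum p n)

open Classical in
/-- The power `b ^ x` for a base `0 < b < 1` and an exponent `x ∈ [0, ∞]`, with `b ^ ∞ = 0`. -/
def powInf (b : ℝ) (x : ℝ≥0∞) : ℝ≥0∞ :=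
  if x = ∞ then 0 else ENNReal.ofReal (b ^ x.toReal)

end ProductCutoff

end

open ProductCutoff

/-!
The generator of the product chain is a sum of commuting operators, so its heat kernel is the
product of the kernels of the coordinates run at speeds `p i / q n`. Comparing overlaps of
product measures, the distance `D` of the product dominates the distance `d i` of every
coordinate, while `∏ (1 - d i ^ ϱ) ≤ 1 - D ^ ϱ`. After the mixing time the distance of a single
chain decays exponentially by submultiplicativity, and the summation condition turns this into
the statement that at the time scale of the last coordinate all coordinates but boundedly many of
the last ones are negligible. If the family has a cutoff, the remaining coordinates mix no later
than the last one, so the product has the cutoff of its last coordinate. Conversely, along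
sufficiently sparse subsequences only the last coordinate of the product matters, so a cutoff of
the products forces one of the factors.
-/

namespace ProductCutoff

section Sums

theorem hasSum_swap {α β : Type*} {f : α → β → ℝ} (hf : ∀ x y, 0 ≤ f x y) {g : α → ℝ} {a : ℝ}
    (h : ∀ x, HasSum (f x) (g x)) (hg : HasSum g a) :
    (∀ y, Summable fun x => f x y) ∧ HasSum (fun y => ∑' x, f x y) a := by
  have hs : Summable fun q : α × β => f q.1 q.2 := by
    refine (summable_prod_of_nonneg fun q => hf _ _).2 ⟨fun x => (h x).summable, ?_⟩
    simpa only [fun x => (h x).tsum_eq] using hg.summable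
  have ha : HasSum (fun q : α × β => f q.1 q.2) a :=
    hg.unique (hs.hasSum.prod_fiberwise h) ▸ hs.hasSum
  have ha' : HasSum (fun q : β × α => f q.2 q.1) a := (Equiv.prodComm β α).hasSum_iff.2 ha
  have hy (y : β) : Summable fun x => f x y := ha'.summable.prod_factor y
  exact ⟨hy, ha'.prod_fiberwise fun y => (hy y).hasSum⟩

theorem hasSum_prod_pi_fin {n : ℕ} {X : Fin n → Type*} {f : ∀ i, X i → ℝ} {a : Fin n → ℝ}
    (h : ∀ i, HasSum (f i) (a i)) :
    HasSum (fun x : ∀ i, X i => ∏ i, f i (x i)) (∏ i, a i) := by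
  induction n with
  | zero => simp
  | succ n ih =>
    have htail := ih fun i => h i.succ
    have hs := summable_mul_of_summable_norm (h 0).summable.norm htail.summable.norm
    rw [Fin.prod_univ_succ, ← (Fin.consEquiv X).hasSum_iff]
    refine ((h 0).mul htail hs).congr_fun fun q => ?_
    rw [Function.comp_apply, Fin.prod_univ_succ]
    rfl

theorem hasSum_prod_pi {ι : Type*} [Fintype ι] {X : ι → Type*} {f : ∀ i, X i → ℝ} {a : ι → ℝ}
    (h : ∀ i, HasSum (f i) (a i)) :
    HasSum (fun x : ∀ i, X i => ∏ i, f i (x i)) (∏ i, a i) := by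
  let e := (Fintype.equivFin ι).symm
  rw [← e.prod_comp, ← (Equiv.piCongrLeft X e).hasSum_iff]
  refine (hasSum_prod_pi_fin fun i => h (e i)).congr_fun fun x => ?_
  rw [Function.comp_apply, ← e.prod_comp]
  simp only [Equiv.piCongrLeft_apply_apply]

end Sums

/-- The Banach space `ℓ¹(α)`, on which the matrices indexed by `α` act from the right. -/
abbrev SummableSpace (α : Type*) := lp (fun _ : α => ℝ) 1

section SummableSpace

variable {α β : Type*} {E : Type*} [NormedAddCommGroup E] [NormedSpace ℝ E]

theorem summable_coe (f : SummableSpace α) : Summable f :=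
  (lp.memℓp f).summable_of_one

theorem hasSum_abs_coe (f : SummableSpace α) : HasSum (fun a => |f a|) ‖f‖ := by
  simpa using lp.hasSum_norm (by simp) f

/-- An absolutely summable family as an element of `ℓ¹`. -/
def ofSummable (f : α → ℝ) (hf : Summable f) : SummableSpace α :=
  ⟨f, memℓp_gen (by simpa using hf.abs)⟩

@[simp] theorem ofSummable_apply (f : α → ℝ) (hf : Summable f) (a : α) :
    ofSummable f hf a = f a := rfl

open Classical in
/-- The unit mass at a point. -/
noncomputable def pointMass (a : α) : SummableSpace α := lp.single 1 a 1

open Classical in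
theorem pointMass_apply (a b : α) : pointMass a b = if a = b then 1 else 0 := by
  simp [pointMass, Pi.single_apply, eq_comm]

theorem norm_pointMass (a : α) : ‖pointMass a‖ = 1 := by
  simp [pointMass, lp.norm_single]

theorem hasSum_pointMass (a : α) : HasSum (pointMass a) 1 := by
  classical
  refine (hasSum_ite_eq a 1).congr_fun fun b => ?_
  rw [pointMass_apply]
  exact if_congr eq_comm rfl rfl

theorem hasSum_smul_pointMass (f : SummableSpace α) :
    HasSum (fun a => f a • pointMass a) f := by
  classical
  refine (lp.hasSum_single ENNReal.one_ne_top f).congr_fun fun a => ?_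
  rw [pointMass, ← lp.single_smul, smul_eq_mul, mul_one]

theorem hasSum_smul_apply_pointMass (T : SummableSpace α →L[ℝ] E) (f : SummableSpace α) :
    HasSum (fun a => f a • T (pointMass a)) (T f) := by
  simpa using T.hasSum (hasSum_smul_pointMass f)

theorem ext_pointMass {T T' : SummableSpace α →L[ℝ] E}
    (h : ∀ a, T (pointMass a) = T' (pointMass a)) : T = T' := by
  ext1 f
  refine (hasSum_smul_apply_pointMass T f).unique ?_
  simpa only [h] using hasSum_smul_apply_pointMass T' f

theorem hasSum_apply (T : SummableSpace α →L[ℝ] SummableSpace β) (f : SummableSpace α) (b : β) :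
    HasSum (fun a => f a * T (pointMass a) b) (T f b) :=
  (hasSum_smul_apply_pointMass T f).mapL (lp.evalCLM ℝ (fun _ : β => ℝ) 1 b)

variable [CompleteSpace E]

/-- The operator on `ℓ¹(α)` with prescribed values on unit masses. -/
noncomputable def kernelOp (k : α → E) {C : ℝ} (hk : ∀ a, ‖k a‖ ≤ C) : SummableSpace α →L[ℝ] E :=
  have hle (f : SummableSpace α) (a : α) : ‖f a • k a‖ ≤ |f a| * C :=
    (norm_smul _ _).trans_le <| mul_le_mul_of_nonneg_left (hk a) (abs_nonneg _)
  have hC (f : SummableSpace α) : HasSum (fun a => |f a| * C) (C * ‖f‖) :=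
    mul_comm C _ ▸ (hasSum_abs_coe f).mul_right C
  have hs (f : SummableSpace α) : Summable fun a => f a • k a :=
    .of_norm_bounded (hC f).summable (hle f)
  LinearMap.mkContinuous
    { toFun f := ∑' a, f a • k a
      map_add' f g := by
        simp only [lp.coeFn_add, Pi.add_apply, add_smul, (hs f).tsum_add (hs g)]
      map_smul' c f := by
        simp only [lp.coeFn_smul, Pi.smul_apply, smul_assoc, (hs f).tsum_const_smul c,
          RingHom.id_apply] }
    C fun f => tsum_of_norm_bounded (hC f) (hle f)

theorem kernelOp_pointMass (k : α → E) {C : ℝ} (hk : ∀ a, ‖k a‖ ≤ C) (a : α) :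
    kernelOp k hk (pointMass a) = k a := by
  change ∑' b, pointMass a b • k b = k a
  rw [tsum_eq_single a fun b hb => by simp [pointMass_apply, hb.symm]]
  simp [pointMass_apply]

end SummableSpace

section Exponential

open NormedSpace

variable {E F : Type*} [NormedAddCommGroup E] [NormedSpace ℝ E] [CompleteSpace E]
  [NormedAddCommGroup F] [NormedSpace ℝ F] [CompleteSpace F]

theorem exp_add_of_commute {A B : E →L[ℝ] E} (h : Commute A B) : exp (A + B) = exp A * exp B := by
  let +nondep : NormedAlgebra ℚ (E →L[ℝ] E) := .restrictScalars ℚ ℝ (E →L[ℝ] E)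
  exact NormedSpace.exp_add_of_commute h

theorem exp_comp_of_comp_eq {A : E →L[ℝ] E} {B : F →L[ℝ] F} {J : E →L[ℝ] F}
    (h : B ∘L J = J ∘L A) : exp B ∘L J = J ∘L exp A := by
  have hpow (n : ℕ) (v : E) : (B ^ n) (J v) = J ((A ^ n) v) := by
    induction n generalizing v with
    | zero => rfl
    | succ n ih => exact (congrArg (B ^ n) (DFunLike.congr_fun h v)).trans (ih (A v))
  have hB := (exp_series_hasSum_exp' (𝕂 := ℝ) B).mapL (ContinuousLinearMap.precomp F J)
  have hA := (exp_series_hasSum_exp' (𝕂 := ℝ) A).mapL (ContinuousLinearMap.postcomp E J)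
  refine hB.unique (hA.congr_fun fun n => ?_)
  ext v
  simp [hpow]

theorem exp_apply_eq_self {A : E →L[ℝ] E} {v : E} (h : A v = 0) : exp A v = v := by
  have := exp_comp_of_comp_eq (A := 0) (B := A) (J := .toSpanSingleton ℝ v) (by ext; simp [h])
  simpa using DFunLike.congr_fun this 1

theorem apply_exp_eq_self {A : E →L[ℝ] E} {φ : E →L[ℝ] F} (h : φ ∘L A = 0) (v : E) :
    φ (exp A v) = φ v := by
  have := exp_comp_of_comp_eq (A := A) (B := 0) (J := φ) (by rw [h, ContinuousLinearMap.zero_comp])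
  simpa using (DFunLike.congr_fun this v).symm

theorem exp_smul_sub_one (T : E →L[ℝ] E) (t : ℝ) :
    exp (t • (T - 1)) = Real.exp (-t) • exp (t • T) := by
  have hone : exp ((-t) • (1 : E →L[ℝ] E)) = Real.exp (-t) • 1 := by
    rw [← Algebra.algebraMap_eq_smul_one, ← Algebra.algebraMap_eq_smul_one, Real.exp_eq_exp_ℝ,
      ← algebraMap_exp_comm]
  rw [smul_sub, sub_eq_neg_add, ← neg_smul, exp_add_of_commute, hone, smul_one_mul]
  exact (Commute.one_left _).smul_left _

end Exponential

/-- The laws of a chain without irreducibility: a stochastic matrix with a stationary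
probability. -/
structure MarkovTriple.IsStationaryChain (M : MarkovTriple.{u}) : Prop where
  K_nonneg : ∀ x y, 0 ≤ M.K x y
  K_sum : ∀ x, HasSum (M.K x) 1
  stat_nonneg : ∀ x, 0 ≤ M.stat x
  stat_sum : HasSum M.stat 1
  stationary : ∀ y, HasSum (fun x => M.stat x * M.K x y) (M.stat y)

theorem MarkovTriple.IsIrreducibleChain.isStationaryChain {M : MarkovTriple.{u}}
    (h : M.IsIrreducibleChain) : M.IsStationaryChain :=
  ⟨h.K_nonneg, h.K_sum, h.stat_nonneg, h.stat_sum, h.stationary⟩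

namespace MarkovTriple.IsStationaryChain

variable {M : MarkovTriple.{u}}

theorem nonempty (h : M.IsStationaryChain) : Nonempty M.State :=
  not_isEmpty_iff.1 fun _ => one_ne_zero (h.stat_sum.unique hasSum_empty)

/-- The operator `μ ↦ μ K` on `ℓ¹`. -/
noncomputable def op (h : M.IsStationaryChain) :
    SummableSpace M.State →L[ℝ] SummableSpace M.State :=
  kernelOp (fun x => ofSummable (M.K x) (h.K_sum x).summable) (C := 1) fun x => by
    rw [← (hasSum_abs_coe _).tsum_eq]
    simp [abs_of_nonneg (h.K_nonneg x _), (h.K_sum x).tsum_eq]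

theorem op_pointMass_apply (h : M.IsStationaryChain) (x y : M.State) :
    h.op (pointMass x) y = M.K x y := by
  rw [op, kernelOp_pointMass, ofSummable_apply]

/-- The operator `μ ↦ μ H_t` on `ℓ¹`. -/
noncomputable def heatOp (h : M.IsStationaryChain) (t : ℝ) :
    SummableSpace M.State →L[ℝ] SummableSpace M.State :=
  NormedSpace.exp (t • (h.op - 1))

theorem iter_eq (h : M.IsStationaryChain) (m : ℕ) (x y : M.State) :
    M.iter m x y = (h.op ^ m) (pointMass x) y := by
  induction m generalizing y with
  | zero => simp [iter, pointMass_apply]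
  | succ m ih =>
    rw [pow_succ', mul_apply_eq_comp, ← (hasSum_apply h.op _ y).tsum_eq]
    simp only [iter, ih, op_pointMass_apply]

theorem heat_eq (h : M.IsStationaryChain) (t : ℝ) (x y : M.State) :
    M.heat t x y = h.heatOp t (pointMass x) y := by
  have hexp := (NormedSpace.exp_series_hasSum_exp' (𝕂 := ℝ) (t • h.op)).mapL
    (lp.evalCLM ℝ (fun _ : M.State => ℝ) 1 y ∘L ContinuousLinearMap.apply ℝ _ (pointMass x))
  rw [heatOp, exp_smul_sub_one]
  refine Eq.trans (tsum_congr fun m => ?_) (hexp.mul_left (Real.exp (-t))).tsum_eq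
  rw [h.iter_eq, smul_pow, smul_smul, mul_assoc, div_eq_inv_mul]
  rfl

theorem iter_nonneg (h : M.IsStationaryChain) (m : ℕ) (x y : M.State) : 0 ≤ M.iter m x y := by
  induction m generalizing y with
  | zero => simp only [iter]; split_ifs <;> simp
  | succ m ih => exact tsum_nonneg fun z => mul_nonneg (ih z) (h.K_nonneg z y)

theorem heat_nonneg (h : M.IsStationaryChain) {t : ℝ} (ht : 0 ≤ t) (x y : M.State) :
    0 ≤ M.heat t x y :=
  tsum_nonneg fun m => mul_nonneg (by positivity) (h.iter_nonneg m x y)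

theorem heat_hasSum (h : M.IsStationaryChain) (t : ℝ) (x : M.State) : HasSum (M.heat t x) 1 := by
  let total := lp.tsumCLM ℝ M.State ℝ
  have htotal (x : M.State) : total (pointMass x) = 1 := (hasSum_pointMass x).tsum_eq
  have hop : total ∘L h.op = total := ext_pointMass fun x => by
    rw [htotal, ContinuousLinearMap.comp_apply, lp.tsumCLM_apply]
    simp only [op_pointMass_apply, (h.K_sum x).tsum_eq]
  have hexp : total (h.heatOp t (pointMass x)) = total (pointMass x) := by
    refine apply_exp_eq_self ?_ _
    rw [ContinuousLinearMap.comp_smul, ContinuousLinearMap.comp_sub, hop]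
    simp [ContinuousLinearMap.one_def]
  rw [htotal] at hexp
  rw [← hexp, funext (h.heat_eq t x)]
  exact (summable_coe _).hasSum

theorem heat_add (h : M.IsStationaryChain) (s t : ℝ) (x y : M.State) :
    HasSum (fun z => M.heat s x z * M.heat t z y) (M.heat (s + t) x y) := by
  have hcomp : h.heatOp (s + t) = h.heatOp t * h.heatOp s := by
    rw [heatOp, add_comm, add_smul, exp_add_of_commute, heatOp, heatOp]
    exact ((Commute.refl _).smul_left _).smul_right _
  simpa only [h.heat_eq, hcomp, mul_apply_eq_comp] using
    hasSum_apply (h.heatOp t) (h.heatOp s (pointMass x)) y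

theorem op_stat (h : M.IsStationaryChain) :
    h.op (ofSummable M.stat h.stat_sum.summable) = ofSummable M.stat h.stat_sum.summable := by
  ext y
  refine (hasSum_apply h.op _ y).unique ?_
  simpa only [ofSummable_apply, op_pointMass_apply] using h.stationary y

theorem heat_stationary (h : M.IsStationaryChain) (t : ℝ) (y : M.State) :
    HasSum (fun x => M.stat x * M.heat t x y) (M.stat y) := by
  let v := ofSummable M.stat h.stat_sum.summable
  have hv : h.heatOp t v = v := by
    refine exp_apply_eq_self ?_
    simp [v, h.op_stat]
  simpa only [hv, v, ofSummable_apply, ← h.heat_eq] using hasSum_apply (h.heatOp t) v y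

end MarkovTriple.IsStationaryChain

section Tensor

open Function NormedSpace

variable {ι : Type*} [Fintype ι] {X : ι → Type*}

theorem norm_ofSummable_prod (v : ∀ i, SummableSpace (X i)) :
    ‖ofSummable (fun x : ∀ i, X i => ∏ i, v i (x i))
      (hasSum_prod_pi fun i => (summable_coe (v i)).hasSum).summable‖ = ∏ i, ‖v i‖ := by
  refine (hasSum_abs_coe _).unique ?_
  simpa only [ofSummable_apply, Finset.abs_prod] using hasSum_prod_pi fun i => hasSum_abs_coe (v i)

/-- The tensor product `(v i) ↦ ⨂ v i` of elements of `ℓ¹`, in particular of probability vectors,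
as a continuous multilinear map. -/
noncomputable def tensor :
    ContinuousMultilinearMap ℝ (fun i => SummableSpace (X i)) (SummableSpace (∀ i, X i)) :=
  let entry (x : ∀ i, X i) : MultilinearMap ℝ (fun i => SummableSpace (X i)) ℝ :=
    (MultilinearMap.mkPiAlgebra ℝ ι ℝ).compLinearMap fun i => lp.evalₗ _ 1 (x i)
  MultilinearMap.mkContinuous
    { toFun v := ofSummable (fun x => ∏ i, v i (x i))
        (hasSum_prod_pi fun i => (summable_coe (v i)).hasSum).summable
      map_update_add' v i a b := by
        ext x
        exact (entry x).map_update_add v i a b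
      map_update_smul' v i c a := by
        ext x
        exact (entry x).map_update_smul v i c a }
    1 fun v => by simp [norm_ofSummable_prod]

@[simp] theorem tensor_apply (v : ∀ i, SummableSpace (X i)) (x : ∀ i, X i) :
    tensor v x = ∏ i, v i (x i) := rfl

theorem norm_tensor (v : ∀ i, SummableSpace (X i)) : ‖tensor v‖ = ∏ i, ‖v i‖ :=
  norm_ofSummable_prod v

theorem tensor_pointMass (x : ∀ i, X i) : tensor (fun i => pointMass (x i)) = pointMass x := by
  ext y
  simp only [tensor_apply, pointMass_apply, Fintype.prod_boole]
  congr 1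
  exact propext funext_iff.symm

theorem apply_tensor {T : ∀ i, SummableSpace (X i) →L[ℝ] SummableSpace (X i)}
    {S : SummableSpace (∀ i, X i) →L[ℝ] SummableSpace (∀ i, X i)}
    (h : ∀ x, S (pointMass x) = tensor fun i => T i (pointMass (x i)))
    (v : ∀ i, SummableSpace (X i)) : S (tensor v) = tensor fun i => T i (v i) := by
  ext y
  refine (hasSum_apply S (tensor v) y).unique ?_
  simpa only [h, tensor_apply, Finset.prod_mul_distrib] using
    hasSum_prod_pi fun i => hasSum_apply (T i) (v i) (y i)

variable [DecidableEq ι]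

/-- The operator `I ⊗ ⋯ ⊗ I ⊗ T ⊗ I ⊗ ⋯ ⊗ I` that acts by `T` on the `i`-th factor. -/
noncomputable def coordOp (i : ι) (T : SummableSpace (X i) →L[ℝ] SummableSpace (X i)) :
    SummableSpace (∀ i, X i) →L[ℝ] SummableSpace (∀ i, X i) :=
  kernelOp (fun x => tensor (update (fun j => pointMass (x j)) i (T (pointMass (x i)))))
    (C := ‖T‖) fun x => by
      rw [norm_tensor, Fintype.prod_eq_mul_prod_compl i, Finset.prod_eq_one]
      · simpa [norm_pointMass] using T.le_opNorm (pointMass (x i))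
      · intro j hj
        simp_all [norm_pointMass]

theorem coordOp_tensor (i : ι) (T : SummableSpace (X i) →L[ℝ] SummableSpace (X i))
    (v : ∀ i, SummableSpace (X i)) : coordOp i T (tensor v) = tensor (update v i (T (v i))) := by
  have hupdate (w : ∀ i, SummableSpace (X i)) : update w i (T (w i)) =
      fun j => update (fun k => ContinuousLinearMap.id ℝ (SummableSpace (X k))) i T j (w j) :=
    funext fun j => (apply_update (fun k (L : SummableSpace (X k) →L[ℝ] SummableSpace (X k)) =>
      L (w k)) (fun k => ContinuousLinearMap.id ℝ (SummableSpace (X k))) i T j).symm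
  rw [hupdate]
  refine apply_tensor (fun x => ?_) v
  rw [← hupdate, coordOp, kernelOp_pointMass]

theorem coordOp_smul_sub_one (i : ι) (T : SummableSpace (X i) →L[ℝ] SummableSpace (X i)) (c : ℝ) :
    coordOp i (c • (T - 1)) = c • (coordOp i T - 1) := by
  refine ext_pointMass fun x => ?_
  simp [← tensor_pointMass, coordOp_tensor]

theorem coordOp_commute {i j : ι} (hij : i ≠ j) (S : SummableSpace (X i) →L[ℝ] SummableSpace (X i))
    (T : SummableSpace (X j) →L[ℝ] SummableSpace (X j)) : Commute (coordOp i S) (coordOp j T) := by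
  refine ext_pointMass fun x => ?_
  simp [← tensor_pointMass, coordOp_tensor, hij, hij.symm, update_comm]

theorem exp_coordOp_tensor (i : ι) (T : SummableSpace (X i) →L[ℝ] SummableSpace (X i))
    (v : ∀ i, SummableSpace (X i)) :
    exp (coordOp i T) (tensor v) = tensor (update v i (exp T (v i))) := by
  have := exp_comp_of_comp_eq (A := T) (B := coordOp i T) (J := tensor.toContinuousLinearMap v i)
    (by ext1 w; simp [coordOp_tensor])
  simpa using DFunLike.congr_fun this (v i)

theorem exp_sum_coordOp_tensor (T : ∀ i, SummableSpace (X i) →L[ℝ] SummableSpace (X i))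
    (v : ∀ i, SummableSpace (X i)) :
    exp (∑ i, coordOp i (T i)) (tensor v) = tensor fun i => exp (T i) (v i) := by
  suffices h : ∀ s : Finset ι, exp (∑ i ∈ s, coordOp i (T i)) (tensor v) =
      tensor (s.piecewise (fun i => exp (T i) (v i)) v) by
    simpa using h Finset.univ
  intro s
  induction s using Finset.induction_on with
  | empty => simp
  | insert i s hi ih =>
    rw [Finset.sum_insert hi, exp_add_of_commute, mul_apply_eq_comp, ih, exp_coordOp_tensor,
      Finset.piecewise_insert, Finset.piecewise_eq_of_notMem _ _ _ hi]
    exact Commute.sum_right _ _ _ fun j hj => coordOp_commute (by grind) _ _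

end Tensor

section Product

open Function

variable {ι : Type} [Fintype ι] {M : ι → MarkovTriple.{u}} {w : ι → ℝ}

open Classical in
/-- The operator `μ ↦ μ K` of the product chain. -/
noncomputable def productOp (h : ∀ i, (M i).IsStationaryChain) (w : ι → ℝ) :
    SummableSpace (∀ i, (M i).State) →L[ℝ] SummableSpace (∀ i, (M i).State) :=
  ∑ i, w i • coordOp i (h i).op

open Classical in
theorem productOp_tensor_apply (h : ∀ i, (M i).IsStationaryChain) (w : ι → ℝ)
    (v : ∀ i, SummableSpace (M i).State) (y : ∀ i, (M i).State) :
    productOp h w (tensor v) y = ∑ i, w i * tensor (update v i ((h i).op (v i))) y := by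
  simp only [productOp, _root_.sum_apply, _root_.smul_apply, coordOp_tensor, lp.coeFn_sum,
    Finset.sum_apply, lp.coeFn_smul, Pi.smul_apply, smul_eq_mul]

theorem productOp_pointMass_apply (h : ∀ i, (M i).IsStationaryChain) (w : ι → ℝ)
    (x y : ∀ i, (M i).State) : productOp h w (pointMass x) y = (productChain M w).K x y := by
  classical
  rw [← tensor_pointMass, productOp_tensor_apply]
  refine Finset.sum_congr rfl fun i _ => ?_
  rw [tensor_apply, ← Finset.mul_prod_erase _ _ (Finset.mem_univ i), update_self,
    (h i).op_pointMass_apply]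
  refine congrArg (fun c => w i * ((M i).K (x i) (y i) * c)) (Finset.prod_congr rfl fun j hj => ?_)
  rw [update_of_ne (Finset.ne_of_mem_erase hj), pointMass_apply]

theorem hasSum_productOp_pointMass (h : ∀ i, (M i).IsStationaryChain) (hw : ∑ i, w i = 1)
    (x : ∀ i, (M i).State) : HasSum (productOp h w (pointMass x)) 1 := by
  classical
  have hfactor (i j : ι) :
      HasSum (update (fun j => pointMass (x j)) i ((h i).op (pointMass (x i))) j) 1 := by
    obtain rfl | hj := eq_or_ne j i
    · rw [update_self]
      exact ((h j).K_sum (x j)).congr_fun ((h j).op_pointMass_apply (x j))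
    · rw [update_of_ne hj]
      exact hasSum_pointMass _
  have hsum := hasSum_sum (s := Finset.univ) fun i _ =>
    (hasSum_prod_pi (hfactor i)).mul_left (w i)
  simp only [Finset.prod_const_one, mul_one, hw] at hsum
  refine hsum.congr_fun fun y => ?_
  rw [← tensor_pointMass, productOp_tensor_apply]
  simp only [tensor_apply]

theorem hasSum_stat_mul_productOp (h : ∀ i, (M i).IsStationaryChain) (hw : ∑ i, w i = 1)
    (y : ∀ i, (M i).State) :
    HasSum (fun x : ∀ i, (M i).State =>
      (∏ i, (M i).stat (x i)) * productOp h w (pointMass x) y) (∏ i, (M i).stat (y i)) := by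
  classical
  let v := tensor fun i => ofSummable (M i).stat (h i).stat_sum.summable
  have hv : productOp h w v y = v y := by
    simp only [v, productOp_tensor_apply, MarkovTriple.IsStationaryChain.op_stat, update_eq_self,
      ← Finset.sum_mul, hw, one_mul]
  have hsum := hasSum_apply (productOp h w) v y
  rwa [hv] at hsum

theorem isStationaryChain_productChain (h : ∀ i, (M i).IsStationaryChain) (hw0 : ∀ i, 0 ≤ w i)
    (hw : ∑ i, w i = 1) : (productChain M w).IsStationaryChain where
  K_nonneg x y := Finset.sum_nonneg fun i _ => mul_nonneg (hw0 i) <|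
    mul_nonneg ((h i).K_nonneg _ _) <| Finset.prod_nonneg fun j _ => by split_ifs <;> norm_num
  K_sum x := (hasSum_productOp_pointMass h hw x).congr_fun fun y =>
    (productOp_pointMass_apply h w x y).symm
  stat_nonneg x := Finset.prod_nonneg fun i _ => (h i).stat_nonneg _
  stat_sum := by
    have := hasSum_prod_pi fun i => (h i).stat_sum
    rwa [Finset.prod_const_one] at this
  stationary y := (hasSum_stat_mul_productOp h hw y).congr_fun fun x =>
    congrArg (_ * ·) (productOp_pointMass_apply h w x y).symm

theorem heat_productChain (h : ∀ i, (M i).IsStationaryChain) (hw0 : ∀ i, 0 ≤ w i)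
    (hw : ∑ i, w i = 1) (t : ℝ) (x y : ∀ i, (M i).State) :
    (productChain M w).heat t x y = ∏ i, (M i).heat (w i * t) (x i) (y i) := by
  classical
  have hP := isStationaryChain_productChain h hw0 hw
  have hop : hP.op = productOp h w := ext_pointMass fun x => by
    ext y
    exact (hP.op_pointMass_apply x y).trans (productOp_pointMass_apply h w x y).symm
  have hgen : t • (productOp h w - 1) = ∑ i, coordOp i ((w i * t) • ((h i).op - 1)) := by
    simp only [coordOp_smul_sub_one]
    simp only [productOp, smul_sub, Finset.smul_sum, smul_smul, mul_comm t,
      Finset.sum_sub_distrib, ← Finset.sum_smul, ← Finset.sum_mul, hw, one_mul]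
  have hexp := exp_sum_coordOp_tensor (fun i => (w i * t) • ((h i).op - 1))
    fun i => pointMass (x i)
  rw [← hgen, ← hop, tensor_pointMass] at hexp
  simp only [(h _).heat_eq]
  exact (hP.heat_eq t x y).trans <|
    (congrFun (congrArg Subtype.val hexp) y).trans (tensor_apply _ y)

end Product

namespace Distance

/-- The power of a distance that equals one minus the overlap of the two probabilities. -/
def order : Distance → ℕ
  | .totalVariation => 1
  | .hellinger => 2

theorem rho_eq (δ : Distance) : δ.rho = δ.order := by
  cases δ <;> simp only [rho, order, Nat.cast_one, Nat.cast_ofNat]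

theorem order_ne_zero (δ : Distance) : δ.order ≠ 0 := by
  cases δ <;> simp only [order, ne_eq, one_ne_zero, OfNat.ofNat_ne_zero, not_false_eq_true]

/-- The mass shared by two masses at a point: the summand `min a b` of the affinity for total
variation, and the summand `√(a b)` of the affinity for the Hellinger distance. -/
noncomputable def common : Distance → ℝ → ℝ → ℝ
  | .totalVariation, a, b => min a b
  | .hellinger, a, b => √(a * b)

/-- The affinity of two nonnegative families, which is `1 - d ^ δ.order` for probabilities at
distance `d`. -/
noncomputable def overlap {α : Type*} (δ : Distance) (μ ν : α → ℝ) : ℝ :=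
  ∑' y, δ.common (μ y) (ν y)

/-- The pointwise discrepancy of two masses, whose sum is twice one minus the overlap. -/
noncomputable def gap : Distance → ℝ → ℝ → ℝ
  | .totalVariation, a, b => |a - b|
  | .hellinger, a, b => (√a - √b) ^ 2

variable (δ : Distance)

theorem common_nonneg {a b : ℝ} (ha : 0 ≤ a) (hb : 0 ≤ b) : 0 ≤ δ.common a b := by
  cases δ
  · exact le_min ha hb
  · exact Real.sqrt_nonneg _

theorem common_zero_zero : δ.common 0 0 = 0 := by
  cases δ <;> simp only [common, min_self, mul_zero, Real.sqrt_zero]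

theorem common_one_one : δ.common 1 1 = 1 := by
  cases δ <;> simp only [common, min_self, mul_one, Real.sqrt_one]

theorem common_mono {a b a' b' : ℝ} (ha : 0 ≤ a) (hb : 0 ≤ b) (haa : a ≤ a') (hbb : b ≤ b') :
    δ.common a b ≤ δ.common a' b' := by
  cases δ
  · exact min_le_min haa hbb
  · exact Real.sqrt_le_sqrt (mul_le_mul haa hbb hb (ha.trans haa))

theorem common_mul_le {a b a' b' : ℝ} (ha : 0 ≤ a) (hb : 0 ≤ b) (ha' : 0 ≤ a') (hb' : 0 ≤ b') :
    δ.common a b * δ.common a' b' ≤ δ.common (a * a') (b * b') := by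
  cases δ
  · exact le_min (mul_le_mul (min_le_left _ _) (min_le_left _ _) (le_min ha' hb') ha)
      (mul_le_mul (min_le_right _ _) (min_le_right _ _) (le_min ha' hb') hb)
  · exact (Real.sqrt_mul (mul_nonneg ha hb) _).symm.trans_le
      (congrArg Real.sqrt (mul_mul_mul_comm a b a' b')).le

theorem common_mul_right {a b c : ℝ} (hc : 0 ≤ c) :
    δ.common (a * c) (b * c) = δ.common a b * c := by
  cases δ
  · exact (min_mul_of_nonneg a b hc).symm
  · simp only [common, mul_mul_mul_comm a c b c, Real.sqrt_mul' _ (mul_self_nonneg c),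
      Real.sqrt_mul_self hc]

theorem common_add_le {a b a' b' : ℝ} (ha : 0 ≤ a) (hb : 0 ≤ b) (ha' : 0 ≤ a') (hb' : 0 ≤ b') :
    δ.common a b + δ.common a' b' ≤ δ.common (a + a') (b + b') := by
  cases δ
  · exact le_min (add_le_add (min_le_left _ _) (min_le_left _ _))
      (add_le_add (min_le_right _ _) (min_le_right _ _))
  · refine Real.le_sqrt_of_sq_le ?_
    have cauchy : (√a * √b + √a' * √b') ^ 2 ≤ (√a ^ 2 + √a' ^ 2) * (√b ^ 2 + √b' ^ 2) := by
      nlinarith [sq_nonneg (√a * √b' - √a' * √b)]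
    rw [Real.sq_sqrt ha, Real.sq_sqrt hb, Real.sq_sqrt ha', Real.sq_sqrt hb'] at cauchy
    simpa only [common, Real.sqrt_mul ha, Real.sqrt_mul ha'] using cauchy

theorem gap_nonneg (a b : ℝ) : 0 ≤ δ.gap a b := by
  cases δ
  · exact abs_nonneg _
  · exact sq_nonneg _

theorem gap_eq {a b : ℝ} (ha : 0 ≤ a) (hb : 0 ≤ b) : δ.gap a b = a + b - 2 * δ.common a b := by
  cases δ
  · simp only [gap, common]
    linarith [max_sub_min_eq_abs a b, max_add_min a b, abs_sub_comm a b]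
  · simp only [gap, common, Real.sqrt_mul ha, sub_sq, Real.sq_sqrt ha, Real.sq_sqrt hb]
    ring

theorem common_le_add {a b : ℝ} (ha : 0 ≤ a) (hb : 0 ≤ b) : δ.common a b ≤ (a + b) / 2 := by
  linarith [δ.gap_nonneg a b, δ.gap_eq ha hb]

theorem prod_common_le {ι : Type*} (s : Finset ι) {f g : ι → ℝ} (hf : ∀ i, 0 ≤ f i)
    (hg : ∀ i, 0 ≤ g i) :
    ∏ i ∈ s, δ.common (f i) (g i) ≤ δ.common (∏ i ∈ s, f i) (∏ i ∈ s, g i) := by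
  classical
  induction s using Finset.induction_on with
  | empty => exact δ.common_one_one.ge
  | insert a s ha ih =>
    simp only [Finset.prod_insert ha]
    exact (mul_le_mul_of_nonneg_left ih (δ.common_nonneg (hf a) (hg a))).trans <|
      δ.common_mul_le (hf a) (hg a) (Finset.prod_nonneg fun i _ => hf i)
        (Finset.prod_nonneg fun i _ => hg i)

theorem sum_common_le {ι : Type*} (s : Finset ι) {f g : ι → ℝ} (hf : ∀ i, 0 ≤ f i)
    (hg : ∀ i, 0 ≤ g i) :
    ∑ i ∈ s, δ.common (f i) (g i) ≤ δ.common (∑ i ∈ s, f i) (∑ i ∈ s, g i) := by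
  classical
  induction s using Finset.induction_on with
  | empty => exact δ.common_zero_zero.ge
  | insert a s ha ih =>
    simp only [Finset.sum_insert ha]
    exact (add_le_add_right ih _).trans <|
      δ.common_add_le (hf a) (hg a) (Finset.sum_nonneg fun i _ => hf i)
        (Finset.sum_nonneg fun i _ => hg i)

variable {α β : Type*} {μ ν : α → ℝ}

theorem hasSum_common (hμ : ∀ y, 0 ≤ μ y) (hν : ∀ y, 0 ≤ ν y) (hμs : Summable μ)
    (hνs : Summable ν) : HasSum (fun y => δ.common (μ y) (ν y)) (δ.overlap μ ν) :=
  (((hμs.add hνs).div_const 2).of_nonneg_of_le (fun y => δ.common_nonneg (hμ y) (hν y))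
    (fun y => δ.common_le_add (hμ y) (hν y))).hasSum

theorem overlap_nonneg (hμ : ∀ y, 0 ≤ μ y) (hν : ∀ y, 0 ≤ ν y) : 0 ≤ δ.overlap μ ν :=
  tsum_nonneg fun y => δ.common_nonneg (hμ y) (hν y)

theorem overlap_le_common {a b : ℝ} (hμ : ∀ y, 0 ≤ μ y) (hν : ∀ y, 0 ≤ ν y) (hμs : HasSum μ a)
    (hνs : HasSum ν b) : δ.overlap μ ν ≤ δ.common a b := by
  refine hasSum_le_of_sum_le (δ.hasSum_common hμ hν hμs.summable hνs.summable) fun s => ?_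
  refine (δ.sum_common_le s hμ hν).trans ?_
  exact δ.common_mono (Finset.sum_nonneg fun i _ => hμ i) (Finset.sum_nonneg fun i _ => hν i)
    (sum_le_hasSum s (fun i _ => hμ i) hμs) (sum_le_hasSum s (fun i _ => hν i) hνs)

theorem overlap_le_one (hμ : ∀ y, 0 ≤ μ y) (hν : ∀ y, 0 ≤ ν y) (hμs : HasSum μ 1)
    (hνs : HasSum ν 1) : δ.overlap μ ν ≤ 1 :=
  δ.common_one_one ▸ δ.overlap_le_common hμ hν hμs hνs

theorem overlap_le_overlap {P : α → β → ℝ} (hP : ∀ x y, 0 ≤ P x y) (hP1 : ∀ x, HasSum (P x) 1)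
    (hμ : ∀ y, 0 ≤ μ y) (hν : ∀ y, 0 ≤ ν y) (hμs : Summable μ) (hνs : Summable ν)
    {μ' ν' : β → ℝ} (hμ' : ∀ y, HasSum (fun x => μ x * P x y) (μ' y))
    (hν' : ∀ y, HasSum (fun x => ν x * P x y) (ν' y)) :
    δ.overlap μ ν ≤ δ.overlap μ' ν' := by
  have image_summable {μ : α → ℝ} {μ' : β → ℝ} (hμ : ∀ y, 0 ≤ μ y) (hμs : Summable μ)
      (hμ' : ∀ y, HasSum (fun x => μ x * P x y) (μ' y)) : Summable μ' := by
    have := (hasSum_swap (fun x y => mul_nonneg (hμ x) (hP x y))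
      (fun x => (hP1 x).mul_left (μ x)) (hμs.mul_right 1).hasSum).2
    simpa only [fun y => (hμ' y).tsum_eq] using this.summable
  have image_nonneg {μ : α → ℝ} {μ' : β → ℝ} (hμ : ∀ y, 0 ≤ μ y)
      (hμ' : ∀ y, HasSum (fun x => μ x * P x y) (μ' y)) (y : β) : 0 ≤ μ' y :=
    (hμ' y).nonneg fun x => mul_nonneg (hμ x) (hP x y)
  have common_image := (hasSum_swap (f := fun x y => δ.common (μ x) (ν x) * P x y)
    (fun x y => mul_nonneg (δ.common_nonneg (hμ x) (hν x)) (hP x y))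
    (fun x => (hP1 x).mul_left _) ((δ.hasSum_common hμ hν hμs hνs).mul_right 1)).2
  rw [mul_one] at common_image
  refine hasSum_le (fun y => ?_) common_image <| δ.hasSum_common (image_nonneg hμ hμ')
    (image_nonneg hν hν') (image_summable hμ hμs hμ') (image_summable hν hνs hν')
  simp only [← δ.common_mul_right (hP _ y)]
  exact δ.overlap_le_common (fun x => mul_nonneg (hμ x) (hP x y))
    (fun x => mul_nonneg (hν x) (hP x y)) (hμ' y) (hν' y)

theorem hasSum_gap (hμ : ∀ y, 0 ≤ μ y) (hν : ∀ y, 0 ≤ ν y) (hμs : HasSum μ 1)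
    (hνs : HasSum ν 1) :
    HasSum (fun y => δ.gap (μ y) (ν y)) (2 * (1 - δ.overlap μ ν)) := by
  have h := (hμs.add hνs).sub ((δ.hasSum_common hμ hν hμs.summable hνs.summable).mul_left 2)
  rw [one_add_one_eq_two, ← mul_one_sub] at h
  exact h.congr_fun fun y => δ.gap_eq (hμ y) (hν y)

end Distance

section InnerProductSpace

variable {H : Type*} [NormedAddCommGroup H] [InnerProductSpace ℝ H] {u v a b : H}

open scoped RealInnerProductSpace

theorem norm_sq_add_smul_add_le (hu : ‖u‖ = 1) (hv : ‖v‖ = 1) (huv : ⟪a, v⟫ = ⟪b, u⟫) :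
    ‖a + b + ‖b‖ • (u + v)‖ ^ 2 ≤ 8 * (‖a‖ + ‖b‖) ^ 2 := by
  have expand : ‖a + b + ‖b‖ • (u + v)‖ ^ 2 = ‖a‖ ^ 2 + 3 * ‖b‖ ^ 2 + 2 * ⟪a, b⟫
      + 2 * ‖b‖ * (⟪a, u⟫ + ⟪a, v⟫ + ⟪b, u⟫ + ⟪b, v⟫) + 2 * ‖b‖ ^ 2 * ⟪u, v⟫ := by
    rw [norm_add_sq_real, norm_add_sq_real a b, norm_smul, norm_norm, mul_pow,
      norm_add_sq_real u v, hu, hv]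
    simp only [real_inner_smul_right, inner_add_left, inner_add_right]
    ring
  have hau : ⟪a, u⟫ ≤ ‖a‖ := by simpa only [hu, mul_one] using real_inner_le_norm a u
  have hav : ⟪a, v⟫ ≤ ‖a‖ := by simpa only [hv, mul_one] using real_inner_le_norm a v
  have hbv : ⟪b, v⟫ ≤ ‖b‖ := by simpa only [hv, mul_one] using real_inner_le_norm b v
  have huv' : ⟪u, v⟫ ≤ 1 := by simpa only [hu, hv, mul_one] using real_inner_le_norm u v
  -- Bounding `⟪b, u⟫` by `‖a‖` instead of `‖b‖` is what keeps the constant at `8`.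
  have hbu : ⟪b, u⟫ ≤ ‖a‖ := huv ▸ hav
  rw [expand]
  nlinarith [norm_nonneg a, norm_nonneg b, real_inner_le_norm a b, sq_nonneg ‖a‖, sq_nonneg ‖b‖,
    mul_le_mul_of_nonneg_left (add_le_add (add_le_add (add_le_add hau hav) hbu) hbv)
      (norm_nonneg b), mul_le_mul_of_nonneg_left huv' (sq_nonneg ‖b‖)]

theorem sq_norm_sub_norm_le (hu : ‖u‖ = 1) (hv : ‖v‖ = 1) (huv : ⟪a, v⟫ = ⟪b, u⟫) :
    (‖a‖ - ‖b‖) ^ 2 ≤ 8 * ‖a - b - ‖b‖ • (u - v)‖ ^ 2 := by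
  have hinner : ⟪a - b - ‖b‖ • (u - v), a + b + ‖b‖ • (u + v)⟫ =
      (‖a‖ - ‖b‖) * (‖a‖ + ‖b‖) := by
    simp only [inner_add_right, inner_sub_left,
      real_inner_smul_left, real_inner_smul_right, real_inner_comm a b, real_inner_comm u v,
      real_inner_comm a u, real_inner_comm a v, real_inner_comm b u, real_inner_comm b v,
      real_inner_self_eq_norm_sq, hu, hv]
    rw [huv]
    ring
  have hcs := abs_real_inner_le_norm (a - b - ‖b‖ • (u - v)) (a + b + ‖b‖ • (u + v))
  obtain h0 | h0 := (add_nonneg (norm_nonneg a) (norm_nonneg b)).eq_or_lt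
  · have ha : ‖a‖ = 0 := by linarith [norm_nonneg a, norm_nonneg b]
    have hb : ‖b‖ = 0 := by linarith [norm_nonneg a, norm_nonneg b]
    rw [ha, hb, sub_self, zero_pow two_ne_zero]
    positivity
  · refine le_of_mul_le_mul_right ?_ (pow_pos h0 2)
    calc (‖a‖ - ‖b‖) ^ 2 * (‖a‖ + ‖b‖) ^ 2
        ≤ (‖a - b - ‖b‖ • (u - v)‖ * ‖a + b + ‖b‖ • (u + v)‖) ^ 2 := by
          rw [← mul_pow, ← hinner, ← sq_abs]
          exact pow_le_pow_left₀ (abs_nonneg _) hcs 2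
      _ ≤ ‖a - b - ‖b‖ • (u - v)‖ ^ 2 * (8 * (‖a‖ + ‖b‖) ^ 2) := by
          rw [mul_pow]
          exact mul_le_mul_of_nonneg_left (norm_sq_add_smul_add_le hu hv huv) (sq_nonneg _)
      _ = 8 * ‖a - b - ‖b‖ • (u - v)‖ ^ 2 * (‖a‖ + ‖b‖) ^ 2 := by ring

end InnerProductSpace

section SqrtVector

variable {α : Type*} {f g : α → ℝ}

/-- The square root of a nonnegative summable family, as a vector of `ℓ²`. -/
noncomputable def sqrtVector (f : α → ℝ) (hf : ∀ y, 0 ≤ f y) (hs : Summable f) :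
    lp (fun _ : α => ℝ) 2 :=
  ⟨fun y => √(f y), memℓp_gen <| hs.congr fun y => by simp [Real.sq_sqrt (hf y)]⟩

theorem hasSum_sq (f : lp (fun _ : α => ℝ) 2) : HasSum (fun y => f y ^ 2) (‖f‖ ^ 2) := by
  simpa [real_inner_self_eq_norm_sq, sq] using lp.hasSum_inner (𝕜 := ℝ) f f

theorem norm_sqrtVector (hf : ∀ y, 0 ≤ f y) {a : ℝ} (hs : HasSum f a) :
    ‖sqrtVector f hf hs.summable‖ = √a := by
  have h : HasSum f (‖sqrtVector f hf hs.summable‖ ^ 2) :=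
    (hasSum_sq _).congr_fun fun y => (Real.sq_sqrt (hf y)).symm
  exact (Real.sqrt_sq (norm_nonneg _)).symm.trans (congrArg Real.sqrt (h.unique hs))

end SqrtVector

namespace Distance

variable {α : Type*} {μ ν Q : α → ℝ} {c n S : ℝ}

theorem hasSum_sub_mul_sub (hμs : HasSum μ 1) (hνs : HasSum ν 1)
    (hc : HasSum (fun y => μ y * Q y) c) (hn : HasSum (fun y => ν y * Q y) n) :
    HasSum (fun y => (μ y - ν y) * (Q y - n)) (c - n) := by
  have h := (hc.sub hn).sub ((hμs.sub hνs).mul_right n)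
  rw [sub_self, zero_mul, sub_zero] at h
  exact h.congr_fun fun y => by ring

theorem totalVariation_gap_le (hμs : HasSum μ 1) (hνs : HasSum ν 1)
    (hc : HasSum (fun y => μ y * Q y) c) (hn : HasSum (fun y => ν y * Q y) n)
    (hS : HasSum (fun y => totalVariation.gap (μ y) (ν y) * totalVariation.gap (Q y) n) S) :
    totalVariation.gap c n ≤ S :=
  (hasSum_sub_mul_sub hμs hνs hc hn).norm_le_of_bounded hS fun _ => (abs_mul _ _).le

theorem hellinger_gap_le (hQ : ∀ y, 0 ≤ Q y) (hμ : ∀ y, 0 ≤ μ y) (hν : ∀ y, 0 ≤ ν y)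
    (hμs : HasSum μ 1) (hνs : HasSum ν 1)
    (hc : HasSum (fun y => μ y * Q y) c) (hn : HasSum (fun y => ν y * Q y) n)
    (hS : HasSum (fun y => hellinger.gap (μ y) (ν y) * hellinger.gap (Q y) n) S) :
    hellinger.gap c n ≤ 8 * S := by
  have hμQ (y : α) : 0 ≤ μ y * Q y := mul_nonneg (hμ y) (hQ y)
  have hνQ (y : α) : 0 ≤ ν y * Q y := mul_nonneg (hν y) (hQ y)
  let u := sqrtVector μ hμ hμs.summable
  let v := sqrtVector ν hν hνs.summable
  let a := sqrtVector _ hμQ hc.summable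
  let b := sqrtVector _ hνQ hn.summable
  have ha : ‖a‖ = √c := norm_sqrtVector hμQ hc
  have hb : ‖b‖ = √n := norm_sqrtVector hνQ hn
  have hu : ‖u‖ = 1 := (norm_sqrtVector hμ hμs).trans Real.sqrt_one
  have hv : ‖v‖ = 1 := (norm_sqrtVector hν hνs).trans Real.sqrt_one
  have huv : inner ℝ a v = inner ℝ b u := by
    simp only [lp.inner_eq_tsum]
    refine tsum_congr fun y => ?_
    change √(ν y) * √(μ y * Q y) = √(μ y) * √(ν y * Q y)
    rw [Real.sqrt_mul (hμ y), Real.sqrt_mul (hν y)]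
    ring
  have hS' : ‖a - b - ‖b‖ • (u - v)‖ ^ 2 = S := by
    refine (hasSum_sq _).unique (hS.congr_fun fun y => ?_)
    change (√(μ y * Q y) - √(ν y * Q y) - ‖b‖ * (√(μ y) - √(ν y))) ^ 2 =
      (√(μ y) - √(ν y)) ^ 2 * (√(Q y) - √n) ^ 2
    rw [hb, Real.sqrt_mul (hμ y), Real.sqrt_mul (hν y)]
    ring
  have h := sq_norm_sub_norm_le hu hv huv
  rwa [hS', ha, hb] at h

variable (δ : Distance)

theorem gap_le (hQ : ∀ y, 0 ≤ Q y) (hμ : ∀ y, 0 ≤ μ y) (hν : ∀ y, 0 ≤ ν y)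
    (hμs : HasSum μ 1) (hνs : HasSum ν 1)
    (hc : HasSum (fun y => μ y * Q y) c) (hn : HasSum (fun y => ν y * Q y) n)
    (hS : HasSum (fun y => δ.gap (μ y) (ν y) * δ.gap (Q y) n) S) :
    δ.gap c n ≤ (2 * δ.rho) ^ δ.order / 2 * S := by
  cases δ
  · have := totalVariation_gap_le hμs hνs hc hn hS
    norm_num [rho, order, this]
  · have := hellinger_gap_le hQ hμ hν hμs hνs hc hn hS
    norm_num [rho, order, this]

theorem one_sub_overlap_le {P : α → α → ℝ} {D : ℝ} (hP : ∀ x y, 0 ≤ P x y)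
    (hP1 : ∀ x, HasSum (P x) 1) (hμ : ∀ y, 0 ≤ μ y) (hν : ∀ y, 0 ≤ ν y) (hμs : HasSum μ 1)
    (hνs : HasSum ν 1) (hνP : ∀ y, HasSum (fun x => ν x * P x y) (ν y)) {μ' : α → ℝ}
    (hμ's : HasSum μ' 1) (hμ' : ∀ y, HasSum (fun x => μ x * P x y) (μ' y))
    (hD : ∀ x, 1 - δ.overlap (P x) ν ≤ D) :
    1 - δ.overlap μ' ν ≤ (2 * δ.rho) ^ δ.order * ((1 - δ.overlap μ ν) * D) := by
  have hμ'0 (y : α) : 0 ≤ μ' y := (hμ' y).nonneg fun x => mul_nonneg (hμ x) (hP x y)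
  have hnn (y z : α) : 0 ≤ δ.gap (μ y) (ν y) * δ.gap (P y z) (ν z) :=
    mul_nonneg (δ.gap_nonneg _ _) (δ.gap_nonneg _ _)
  have hrow (y : α) : HasSum (fun z => δ.gap (μ y) (ν y) * δ.gap (P y z) (ν z))
      (δ.gap (μ y) (ν y) * (2 * (1 - δ.overlap (P y) ν))) :=
    (δ.hasSum_gap (hP y) hν (hP1 y) hνs).mul_left _
  have hrow_le (y : α) : δ.gap (μ y) (ν y) * (2 * (1 - δ.overlap (P y) ν)) ≤
      δ.gap (μ y) (ν y) * (2 * D) :=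
    mul_le_mul_of_nonneg_left (by linarith [hD y]) (δ.gap_nonneg _ _)
  have hbound := (δ.hasSum_gap hμ hν hμs hνs).mul_right (2 * D)
  have hrows := (hbound.summable.of_nonneg_of_le (fun y => (hrow y).nonneg (hnn y)) hrow_le).hasSum
  have hrows_le := hasSum_le hrow_le hrows hbound
  obtain ⟨hcol, hcols⟩ := hasSum_swap hnn hrow hrows
  have hgap := hasSum_le
    (fun z => δ.gap_le (fun y => hP y z) hμ hν hμs hνs (hμ' z) (hνP z) (hcol z).hasSum)
    (δ.hasSum_gap hμ'0 hν hμ's hνs) (hcols.mul_left _)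
  have hρ : 0 ≤ (2 * δ.rho) ^ δ.order := by
    rw [δ.rho_eq]
    positivity
  linarith [mul_le_mul_of_nonneg_left hrows_le hρ]

end Distance

section TotalVariation

variable {α : Type*} {μ ν : α → ℝ}

theorem isGreatest_tsum_subtype_sub (hμ : ∀ y, 0 ≤ μ y) (hν : ∀ y, 0 ≤ ν y) (hμs : HasSum μ 1)
    (hνs : HasSum ν 1) :
    IsGreatest (Set.range fun A : Set α => (∑' y : A, μ y) - ∑' y : A, ν y)
      (1 - Distance.totalVariation.overlap μ ν) := by
  have hdiff (A : Set α) : HasSum (fun y => A.indicator μ y - A.indicator ν y)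
      ((∑' y : A, μ y) - ∑' y : A, ν y) := by
    rw [tsum_subtype, tsum_subtype]
    exact (hμs.summable.indicator A).hasSum.sub (hνs.summable.indicator A).hasSum
  have hexcess : HasSum (fun y => μ y - min (μ y) (ν y))
      (1 - Distance.totalVariation.overlap μ ν) :=
    hμs.sub (Distance.totalVariation.hasSum_common hμ hν hμs.summable hνs.summable)
  refine ⟨⟨{y | ν y ≤ μ y}, (hdiff _).unique (hexcess.congr_fun fun y => ?_)⟩, ?_⟩
  · by_cases hy : y ∈ {y | ν y ≤ μ y}
    · rw [Set.indicator_of_mem hy, Set.indicator_of_mem hy, min_eq_right hy]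
    · rw [Set.indicator_of_notMem hy, Set.indicator_of_notMem hy, min_eq_left (not_le.1 hy).le,
        sub_self, sub_self]
  · rintro _ ⟨A, rfl⟩
    refine hasSum_le (fun y => ?_) (hdiff A) hexcess
    by_cases hy : y ∈ A
    · rw [Set.indicator_of_mem hy, Set.indicator_of_mem hy]
      exact sub_le_sub_left (min_le_right _ _) _
    · rw [Set.indicator_of_notMem hy, Set.indicator_of_notMem hy, sub_self]
      exact sub_nonneg.2 (min_le_left _ _)

end TotalVariation

namespace MarkovTriple.IsStationaryChain

variable {M : MarkovTriple.{u}} {s t : ℝ}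

theorem one_sub_overlap_mem_Icc (h : M.IsStationaryChain) (ht : 0 ≤ t) (δ : Distance)
    (x : M.State) : 1 - δ.overlap (M.heat t x) M.stat ∈ Set.Icc 0 1 :=
  ⟨sub_nonneg.2 <| δ.overlap_le_one (h.heat_nonneg ht x) h.stat_nonneg (h.heat_hasSum t x)
    h.stat_sum, sub_le_self 1 <| δ.overlap_nonneg (h.heat_nonneg ht x) h.stat_nonneg⟩

theorem isLUB_dTV (h : M.IsStationaryChain) (ht : 0 ≤ t) :
    IsLUB (Set.range fun x => 1 - Distance.totalVariation.overlap (M.heat t x) M.stat)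
      (M.dTV t) := by
  have hA (x : M.State) := isGreatest_tsum_subtype_sub (h.heat_nonneg ht x) h.stat_nonneg
    (h.heat_hasSum t x) h.stat_sum
  have hlub : IsLUB (Set.range fun q : M.State × Set M.State =>
      (∑' y : q.2, M.heat t q.1 y) - ∑' y : q.2, M.stat y) (M.dTV t) := by
    have : Nonempty M.State := h.nonempty
    refine isLUB_ciSup ⟨1, ?_⟩
    rintro _ ⟨⟨x, A⟩, rfl⟩
    exact ((hA x).2 ⟨A, rfl⟩).trans (h.one_sub_overlap_mem_Icc ht _ x).2
  refine ⟨?_, fun c hc => hlub.2 ?_⟩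
  · rintro _ ⟨x, rfl⟩
    obtain ⟨A, hA⟩ := (hA x).1
    exact hlub.1 ⟨(x, A), hA⟩
  · rintro _ ⟨⟨x, A⟩, rfl⟩
    exact ((hA x).2 ⟨A, rfl⟩).trans (hc ⟨x, rfl⟩)

theorem isLUB_dH_sq (h : M.IsStationaryChain) (ht : 0 ≤ t) :
    IsLUB (Set.range fun x => 1 - Distance.hellinger.overlap (M.heat t x) M.stat)
      (M.dH t ^ 2) := by
  have : Nonempty M.State := h.nonempty
  have hsum (x : M.State) : (1 / 2) * ∑' y, (√(M.heat t x y) - √(M.stat y)) ^ 2 =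
      1 - Distance.hellinger.overlap (M.heat t x) M.stat := by
    have := (Distance.hellinger.hasSum_gap (h.heat_nonneg ht x) h.stat_nonneg
      (h.heat_hasSum t x) h.stat_sum).tsum_eq
    simp only [Distance.gap] at this
    rw [this]
    ring
  have hlub : IsLUB (Set.range fun x => √(1 - Distance.hellinger.overlap (M.heat t x) M.stat))
      (M.dH t) := by
    simp only [← hsum]
    refine isLUB_ciSup ⟨1, ?_⟩
    rintro _ ⟨x, rfl⟩
    simp only [hsum]
    exact Real.sqrt_le_one.2 (h.one_sub_overlap_mem_Icc ht _ x).2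
  refine ⟨?_, fun c hc => ?_⟩
  · rintro _ ⟨x, rfl⟩
    exact (Real.sqrt_le_iff.1 (hlub.1 ⟨x, rfl⟩)).2
  · have hdH : M.dH t ≤ √c := hlub.2 <| by
      rintro _ ⟨x, rfl⟩
      exact Real.sqrt_le_sqrt (hc ⟨x, rfl⟩)
    have hc0 : 0 ≤ c := (h.one_sub_overlap_mem_Icc ht _ (Classical.arbitrary _)).1.trans
      (hc ⟨Classical.arbitrary _, rfl⟩)
    exact (Real.le_sqrt (Real.iSup_nonneg fun x => Real.sqrt_nonneg _) hc0).1 hdH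

theorem isLUB_maxDist_pow (h : M.IsStationaryChain) (ht : 0 ≤ t) (δ : Distance) :
    IsLUB (Set.range fun x => 1 - δ.overlap (M.heat t x) M.stat) (maxDist δ M t ^ δ.order) := by
  cases δ
  · simpa only [maxDist, Distance.order, pow_one] using h.isLUB_dTV ht
  · exact h.isLUB_dH_sq ht

theorem maxDist_nonneg (h : M.IsStationaryChain) (ht : 0 ≤ t) (δ : Distance) :
    0 ≤ maxDist δ M t := by
  cases δ
  · obtain ⟨x⟩ := h.nonempty
    exact (h.one_sub_overlap_mem_Icc ht _ x).1.trans ((h.isLUB_dTV ht).1 ⟨x, rfl⟩)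
  · exact Real.iSup_nonneg fun x => Real.sqrt_nonneg _

theorem one_sub_overlap_le_pow (h : M.IsStationaryChain) (ht : 0 ≤ t) (δ : Distance)
    (x : M.State) : 1 - δ.overlap (M.heat t x) M.stat ≤ maxDist δ M t ^ δ.order :=
  (h.isLUB_maxDist_pow ht δ).1 ⟨x, rfl⟩

theorem maxDist_pow_le (h : M.IsStationaryChain) (ht : 0 ≤ t) (δ : Distance) {c : ℝ}
    (hc : ∀ x, 1 - δ.overlap (M.heat t x) M.stat ≤ c) : maxDist δ M t ^ δ.order ≤ c :=
  (h.isLUB_maxDist_pow ht δ).2 <| by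
    rintro _ ⟨x, rfl⟩
    exact hc x

theorem maxDist_le_of_pow_le (h : M.IsStationaryChain) (ht : 0 ≤ t) (δ : Distance) {c : ℝ}
    (hc0 : 0 ≤ c) (hc : ∀ x, 1 - δ.overlap (M.heat t x) M.stat ≤ c ^ δ.order) :
    maxDist δ M t ≤ c :=
  (pow_le_pow_iff_left₀ (h.maxDist_nonneg ht δ) hc0 δ.order_ne_zero).1 (h.maxDist_pow_le ht δ hc)

theorem maxDist_mem_Icc (h : M.IsStationaryChain) (ht : 0 ≤ t) (δ : Distance) :
    maxDist δ M t ∈ Set.Icc 0 1 :=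
  ⟨h.maxDist_nonneg ht δ, h.maxDist_le_of_pow_le ht δ zero_le_one fun x =>
    (h.one_sub_overlap_mem_Icc ht δ x).2.trans_eq (one_pow _).symm⟩

theorem maxDist_pow_mem_Icc (h : M.IsStationaryChain) (ht : 0 ≤ t) (δ : Distance) (k : ℕ) :
    maxDist δ M t ^ k ∈ Set.Icc 0 1 :=
  ⟨pow_nonneg (h.maxDist_mem_Icc ht δ).1 k, pow_le_one₀ (h.maxDist_mem_Icc ht δ).1
    (h.maxDist_mem_Icc ht δ).2⟩

theorem maxDist_anti (h : M.IsStationaryChain) (δ : Distance) (hs : 0 ≤ s)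
    (hst : s ≤ t) : maxDist δ M t ≤ maxDist δ M s := by
  refine h.maxDist_le_of_pow_le (hs.trans hst) δ (h.maxDist_nonneg hs δ) fun x => ?_
  refine (sub_le_sub_left ?_ 1).trans (h.one_sub_overlap_le_pow hs δ x)
  refine δ.overlap_le_overlap (h.heat_nonneg (sub_nonneg.2 hst)) (h.heat_hasSum (t - s))
    (h.heat_nonneg hs x) h.stat_nonneg (h.heat_hasSum s x).summable h.stat_sum.summable
    (fun y => ?_) (h.heat_stationary (t - s))
  have := h.heat_add s (t - s) x y
  rwa [add_sub_cancel] at this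

theorem maxDist_add_le (h : M.IsStationaryChain) (δ : Distance) (hs : 0 ≤ s) (ht : 0 ≤ t) :
    maxDist δ M (s + t) ≤ 2 * δ.rho * (maxDist δ M s * maxDist δ M t) := by
  have hρ : 0 ≤ 2 * δ.rho := by rw [δ.rho_eq]; positivity
  have hdt := h.maxDist_nonneg ht δ
  refine h.maxDist_le_of_pow_le (add_nonneg hs ht) δ
    (mul_nonneg hρ (mul_nonneg (h.maxDist_nonneg hs δ) hdt)) fun x => ?_
  calc 1 - δ.overlap (M.heat (s + t) x) M.stat
      ≤ (2 * δ.rho) ^ δ.order *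
        ((1 - δ.overlap (M.heat s x) M.stat) * maxDist δ M t ^ δ.order) :=
        δ.one_sub_overlap_le (h.heat_nonneg ht) (h.heat_hasSum t) (h.heat_nonneg hs x)
          h.stat_nonneg (h.heat_hasSum s x) h.stat_sum (h.heat_stationary t)
          (h.heat_hasSum (s + t) x) (fun y => h.heat_add s t x y) (h.one_sub_overlap_le_pow ht δ)
    _ ≤ (2 * δ.rho) ^ δ.order * (maxDist δ M s ^ δ.order * maxDist δ M t ^ δ.order) := by
        gcongr
        exact h.one_sub_overlap_le_pow hs δ x
    _ = (2 * δ.rho * (maxDist δ M s * maxDist δ M t)) ^ δ.order := by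
        rw [mul_pow (2 * δ.rho) (_ * _), mul_pow (maxDist δ M s)]

theorem maxDist_succ_mul_le (h : M.IsStationaryChain) (δ : Distance) (ht : 0 ≤ t) (k : ℕ) :
    2 * δ.rho * maxDist δ M ((k + 1 : ℕ) * t) ≤ (2 * δ.rho * maxDist δ M t) ^ (k + 1) := by
  have hρ : 0 ≤ 2 * δ.rho := by rw [δ.rho_eq]; positivity
  induction k with
  | zero => rw [zero_add, Nat.cast_one, one_mul, pow_one]
  | succ k ih =>
    calc 2 * δ.rho * maxDist δ M ((k + 1 + 1 : ℕ) * t)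
        = 2 * δ.rho * maxDist δ M ((k + 1 : ℕ) * t + t) := by
          rw [Nat.cast_succ (k + 1), add_one_mul]
      _ ≤ 2 * δ.rho * (2 * δ.rho * (maxDist δ M ((k + 1 : ℕ) * t) * maxDist δ M t)) :=
          mul_le_mul_of_nonneg_left (h.maxDist_add_le δ (by positivity) ht) hρ
      _ = 2 * δ.rho * maxDist δ M ((k + 1 : ℕ) * t) * (2 * δ.rho * maxDist δ M t) := by ring
      _ ≤ (2 * δ.rho * maxDist δ M t) ^ (k + 1) * (2 * δ.rho * maxDist δ M t) :=
          mul_le_mul_of_nonneg_right ih (mul_nonneg hρ (h.maxDist_nonneg ht δ))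
      _ = (2 * δ.rho * maxDist δ M t) ^ (k + 1 + 1) := (pow_succ _ _).symm

end MarkovTriple.IsStationaryChain

section ProductOverlap

open Function

variable {ι : Type*} [Fintype ι] {X : ι → Type*} {μ ν : ∀ i, X i → ℝ}

theorem hasSum_marginal {i : ι} [DecidableEq (X i)] (hμ : ∀ j, HasSum (μ j) 1)
    (z : X i) :
    HasSum (fun y : ∀ i, X i => (∏ j, μ j (y j)) * if y i = z then 1 else 0) (μ i z) := by
  classical
  have hfactor (j : ι) : HasSum (update μ i (Pi.single z (μ i z)) j)
      (update (fun _ => (1 : ℝ)) i (μ i z) j) := by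
    obtain rfl | hj := eq_or_ne j i
    · rw [update_self, update_self]
      exact hasSum_pi_single z _
    · rw [update_of_ne hj, update_of_ne hj]
      exact hμ j
  have hsum := hasSum_prod_pi hfactor
  rw [Finset.prod_update_of_mem (Finset.mem_univ _), Finset.prod_const_one, mul_one] at hsum
  refine hsum.congr_fun fun y => ?_
  rw [← Finset.mul_prod_erase _ _ (Finset.mem_univ i),
    ← Finset.mul_prod_erase Finset.univ (fun j => update μ i (Pi.single z (μ i z)) j (y j))
      (Finset.mem_univ i), update_self,
    Finset.prod_congr rfl fun j hj =>
      congrFun (update_of_ne (Finset.ne_of_mem_erase hj) (Pi.single z (μ i z)) μ) (y j)]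
  obtain rfl | hz := eq_or_ne (y i) z
  · rw [Pi.single_eq_same, if_pos rfl, mul_one]
  · rw [Pi.single_eq_of_ne hz, if_neg hz, mul_zero, zero_mul]

theorem hasSum_prod_pi_one (hμ : ∀ i, HasSum (μ i) 1) :
    HasSum (fun x : ∀ i, X i => ∏ i, μ i (x i)) 1 := by
  simpa only [Finset.prod_const_one] using hasSum_prod_pi hμ

variable (δ : Distance) (hμ : ∀ i x, 0 ≤ μ i x) (hν : ∀ i x, 0 ≤ ν i x)
  (hμ1 : ∀ i, HasSum (μ i) 1) (hν1 : ∀ i, HasSum (ν i) 1)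
include hμ hν hμ1 hν1

theorem overlap_pi_le (i : ι) :
    δ.overlap (fun y : ∀ i, X i => ∏ j, μ j (y j)) (fun y => ∏ j, ν j (y j)) ≤
      δ.overlap (μ i) (ν i) := by
  classical
  refine δ.overlap_le_overlap (P := fun (y : ∀ i, X i) z => if y i = z then 1 else 0)
    (fun y z => by positivity) (fun y => ?_)
    (fun y => Finset.prod_nonneg fun j _ => hμ _ _) (fun y => Finset.prod_nonneg fun j _ => hν _ _)
    (hasSum_prod_pi_one hμ1).summable (hasSum_prod_pi_one hν1).summable
    (hasSum_marginal hμ1) (hasSum_marginal hν1)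
  exact (hasSum_ite_eq (y i) 1).congr_fun fun z => if_congr eq_comm rfl rfl

theorem prod_overlap_le :
    ∏ i, δ.overlap (μ i) (ν i) ≤
      δ.overlap (fun y : ∀ i, X i => ∏ j, μ j (y j)) (fun y => ∏ j, ν j (y j)) := by
  have hprod := hasSum_prod_pi fun i =>
    δ.hasSum_common (hμ i) (hν i) (hμ1 i).summable (hν1 i).summable
  refine hasSum_le (fun y => ?_) hprod <| δ.hasSum_common
    (fun y => Finset.prod_nonneg fun j _ => hμ j (y j))
    (fun y => Finset.prod_nonneg fun j _ => hν j (y j))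
    (hasSum_prod_pi_one hμ1).summable (hasSum_prod_pi_one hν1).summable
  exact δ.prod_common_le Finset.univ (fun i => hμ i (y i)) fun i => hν i (y i)

end ProductOverlap

section ProductDistance

variable {ι : Type} [Fintype ι] {M : ι → MarkovTriple.{u}} {w : ι → ℝ} {t : ℝ}

theorem overlap_productChain (h : ∀ i, (M i).IsStationaryChain) (hw0 : ∀ i, 0 ≤ w i)
    (hw : ∑ i, w i = 1) (δ : Distance) (t : ℝ) (x : ∀ i, (M i).State) :
    δ.overlap (MarkovTriple.heat (productChain M w) t x) (productChain M w).stat =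
      δ.overlap (fun y : ∀ i, (M i).State => ∏ j, (M j).heat (w j * t) (x j) (y j))
        (fun y => ∏ j, (M j).stat (y j)) :=
  congrArg (δ.overlap (α := ∀ i, (M i).State) · (productChain M w).stat) <|
    funext <| heat_productChain h hw0 hw t x

theorem maxDist_le_maxDist_productChain (h : ∀ i, (M i).IsStationaryChain) (hw0 : ∀ i, 0 ≤ w i)
    (hw : ∑ i, w i = 1) (δ : Distance) (ht : 0 ≤ t) (i : ι) :
    maxDist δ (M i) (w i * t) ≤ maxDist δ (productChain M w) t := by
  classical
  have hP := isStationaryChain_productChain h hw0 hw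
  have hwt (i : ι) : 0 ≤ w i * t := mul_nonneg (hw0 i) ht
  refine (h i).maxDist_le_of_pow_le (hwt i) δ (hP.maxDist_nonneg ht δ) fun z => ?_
  obtain ⟨x, rfl⟩ : ∃ x : ∀ j, (M j).State, x i = z :=
    ⟨Function.update (fun j => (h j).nonempty.some) i z, Function.update_self _ _ _⟩
  refine (sub_le_sub_left ?_ 1).trans (hP.one_sub_overlap_le_pow ht δ x)
  exact (overlap_productChain h hw0 hw δ t x).trans_le <|
    overlap_pi_le δ (fun j => (h j).heat_nonneg (hwt j) (x j)) (fun j => (h j).stat_nonneg)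
      (fun j => (h j).heat_hasSum _ _) (fun j => (h j).stat_sum) i

theorem prod_one_sub_le_one_sub_maxDist_productChain (h : ∀ i, (M i).IsStationaryChain)
    (hw0 : ∀ i, 0 ≤ w i) (hw : ∑ i, w i = 1) (δ : Distance) (ht : 0 ≤ t) :
    ∏ i, (1 - maxDist δ (M i) (w i * t) ^ δ.order) ≤
      1 - maxDist δ (productChain M w) t ^ δ.order := by
  have hwt (i : ι) : 0 ≤ w i * t := mul_nonneg (hw0 i) ht
  refine le_sub_comm.1 <| (isStationaryChain_productChain h hw0 hw).maxDist_pow_le ht δ fun x => ?_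
  refine sub_le_sub_left (le_trans ?_ <| (prod_overlap_le δ
    (fun j => (h j).heat_nonneg (hwt j) (x j)) (fun j => (h j).stat_nonneg)
    (fun j => (h j).heat_hasSum _ _) (fun j => (h j).stat_sum)).trans_eq
      (overlap_productChain h hw0 hw δ t x).symm) 1
  exact Finset.prod_le_prod
    (fun i _ => sub_nonneg.2 ((h i).maxDist_pow_mem_Icc (hwt i) δ _).2)
    fun i _ => sub_le_comm.1 ((h i).one_sub_overlap_le_pow (hwt i) δ (x i))

end ProductDistance

theorem one_sub_sum_le_prod_one_sub {ι : Type*} (s : Finset ι) {x : ι → ℝ}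
    (hx : ∀ i, x i ∈ Set.Icc 0 1) : 1 - ∑ i ∈ s, x i ≤ ∏ i ∈ s, (1 - x i) := by
  classical
  induction s using Finset.induction_on with
  | empty => simp
  | insert a s ha ih =>
    rw [Finset.sum_insert ha, Finset.prod_insert ha]
    have hs : 0 ≤ ∑ i ∈ s, x i := Finset.sum_nonneg fun i _ => (hx i).1
    nlinarith [mul_le_mul_of_nonneg_left ih (sub_nonneg.2 (hx a).2), mul_nonneg (hx a).1 hs]

theorem sum_range_comp_le_sum_range {f : ℕ → ℝ} (hf : ∀ i, 0 ≤ f i) {ξ : ℕ → ℕ}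
    (hξ : StrictMono ξ) {k l : ℕ} (hkl : ∀ i < k, ξ i < l) :
    ∑ i ∈ Finset.range k, f (ξ i) ≤ ∑ i ∈ Finset.range l, f i := by
  rw [← Finset.sum_image hξ.injective.injOn]
  refine Finset.sum_le_sum_of_subset_of_nonneg (Finset.image_subset_iff.2 fun i hi => ?_)
    fun i _ _ => hf i
  exact Finset.mem_range.2 (hkl i (Finset.mem_range.1 hi))

section ReferenceTime

variable {δ : Distance} {G : ℕ → MarkovTriple.{u}} {σ t : ℕ → ℝ}

/-- Eventually positive times `σ n` of which every smaller proportion leaves the distance of the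
`n`-th chain bounded away from `0`, and every larger proportion bounds it away from `1`. Mixing
times are of this kind whether or not the family has a cutoff; if it has one, then it occurs at
`σ n`. -/
structure IsReferenceTime (δ : Distance) (G : ℕ → MarkovTriple.{u}) (σ : ℕ → ℝ) : Prop where
  chain : ∀ n, (G n).IsStationaryChain
  pos : ∀ᶠ n in atTop, 0 < σ n
  lower : ∀ a, 0 < a → a < 1 → ∃ e > 0, ∀ᶠ n in atTop, e ≤ maxDist δ (G n) (a * σ n)
  upper : ∀ a, 1 < a → ∃ e < 1, ∀ᶠ n in atTop, maxDist δ (G n) (a * σ n) ≤ e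

theorem IsCutoffTime.comp (h : IsCutoffTime δ G t) {ξ : ℕ → ℕ} (hξ : StrictMono ξ) :
    IsCutoffTime δ (G ∘ ξ) (t ∘ ξ) :=
  ⟨fun _ => h.1 _, fun a ha => (h.2.1 a ha).comp hξ.tendsto_atTop,
    fun a ha ha' => (h.2.2 a ha ha').comp hξ.tendsto_atTop⟩

theorem HasCutoff.of_eventually_pos (hpos : ∀ᶠ n in atTop, 0 < σ n)
    (h0 : ∀ a, 1 < a → Tendsto (fun n => maxDist δ (G n) (a * σ n)) atTop (𝓝 0))
    (h1 : ∀ a, 0 < a → a < 1 → Tendsto (fun n => maxDist δ (G n) (a * σ n)) atTop (𝓝 1)) :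
    HasCutoff δ G := by
  classical
  have heq (a : ℝ) : (fun n => maxDist δ (G n) (a * σ n)) =ᶠ[atTop]
      fun n => maxDist δ (G n) (a * if 0 < σ n then σ n else 1) :=
    hpos.mono fun n hn => by simp only [if_pos hn]
  refine ⟨fun n => if 0 < σ n then σ n else 1, fun n => ?_, fun a ha => (h0 a ha).congr' (heq a),
    fun a ha ha' => (h1 a ha ha').congr' (heq a)⟩
  dsimp only
  split_ifs with hn
  · exact hn
  · exact one_pos

namespace IsReferenceTime

theorem eventually_maxDist_mem_Icc (h : IsReferenceTime δ G σ) {a : ℝ} (ha : 0 < a) :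
    ∀ᶠ n in atTop, maxDist δ (G n) (a * σ n) ∈ Set.Icc 0 1 :=
  h.pos.mono fun n hn => (h.chain n).maxDist_mem_Icc (mul_pos ha hn).le δ

theorem eventually_mul_le (h : IsReferenceTime δ G σ) (ht : IsCutoffTime δ G t) {θ : ℝ}
    (hθ0 : 0 < θ) (hθ : θ < 1) : ∀ᶠ n in atTop, θ * t n ≤ σ n := by
  obtain ⟨a, ha, haθ⟩ := exists_between ((one_lt_inv₀ hθ0).2 hθ)
  have ha0 : 0 < a := zero_lt_one.trans ha
  obtain ⟨e, he, hup⟩ := h.upper a ha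
  have haθ1 : a * θ < 1 := (lt_div_iff₀ hθ0).1 (haθ.trans_eq (one_div θ).symm)
  filter_upwards [hup, h.pos, (ht.2.2 (a * θ) (mul_pos ha0 hθ0) haθ1).eventually_const_lt he]
    with n hn hσ het
  by_contra! hlt
  refine hn.not_gt (het.trans_le ((h.chain n).maxDist_anti δ (mul_pos ha0 hσ).le ?_))
  rw [mul_assoc]
  exact mul_le_mul_of_nonneg_left hlt.le ha0.le

theorem eventually_le_mul (h : IsReferenceTime δ G σ) (ht : IsCutoffTime δ G t) {θ : ℝ}
    (hθ : 1 < θ) : ∀ᶠ n in atTop, σ n ≤ θ * t n := by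
  have hθ0 : 0 < θ := zero_lt_one.trans hθ
  obtain ⟨a, haθ, ha⟩ := exists_between (inv_lt_one_of_one_lt₀ hθ)
  have ha0 : 0 < a := (inv_pos.2 hθ0).trans haθ
  obtain ⟨e, he, hlow⟩ := h.lower a ha0 ha
  have haθ1 : 1 < a * θ := (inv_lt_iff_one_lt_mul₀ hθ0).1 haθ
  filter_upwards [hlow, (ht.2.1 (a * θ) haθ1).eventually_lt_const he] with n hn het
  by_contra! hlt
  refine het.not_ge (hn.trans ((h.chain n).maxDist_anti δ
    (mul_pos (mul_pos ha0 hθ0) (ht.1 n)).le ?_))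
  rw [mul_assoc]
  exact mul_le_mul_of_nonneg_left hlt.le ha0.le

theorem tendsto_zero (h : IsReferenceTime δ G σ) (hG : HasCutoff δ G) {a : ℝ} (ha : 1 < a) :
    Tendsto (fun n => maxDist δ (G n) (a * σ n)) atTop (𝓝 0) := by
  obtain ⟨t, ht⟩ := hG
  have ha0 : 0 < a := zero_lt_one.trans ha
  obtain ⟨θ, hθ1, hθ⟩ := exists_between (inv_lt_one_of_one_lt₀ ha)
  have hθ0 : 0 < θ := (inv_pos.2 ha0).trans hθ1
  have haθ : 1 < a * θ := (inv_lt_iff_one_lt_mul₀' ha0).1 hθ1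
  refine squeeze_zero' ((h.eventually_maxDist_mem_Icc ha0).mono fun n hn => hn.1) ?_
    (ht.2.1 (a * θ) haθ)
  filter_upwards [h.eventually_mul_le ht hθ0 hθ] with n hn
  refine (h.chain n).maxDist_anti δ (mul_pos (mul_pos ha0 hθ0) (ht.1 n)).le ?_
  rw [mul_assoc]
  exact mul_le_mul_of_nonneg_left hn ha0.le

theorem tendsto_one (h : IsReferenceTime δ G σ) (hG : HasCutoff δ G) {a : ℝ} (ha0 : 0 < a)
    (ha : a < 1) : Tendsto (fun n => maxDist δ (G n) (a * σ n)) atTop (𝓝 1) := by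
  obtain ⟨t, ht⟩ := hG
  obtain ⟨θ, hθ, hθ1⟩ := exists_between ((one_lt_inv₀ ha0).2 ha)
  have hθ0 : 0 < θ := zero_lt_one.trans hθ
  have haθ : a * θ < 1 := (lt_div_iff₀' ha0).1 (hθ1.trans_eq (one_div a).symm)
  refine tendsto_of_tendsto_of_tendsto_of_le_of_le' (ht.2.2 (a * θ) (mul_pos ha0 hθ0) haθ)
    tendsto_const_nhds ?_ ((h.eventually_maxDist_mem_Icc ha0).mono fun n hn => hn.2)
  filter_upwards [h.eventually_le_mul ht hθ, h.pos] with n hn hσ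
  refine (h.chain n).maxDist_anti δ (mul_pos ha0 hσ).le ?_
  rw [mul_assoc]
  exact mul_le_mul_of_nonneg_left hn ha0.le

end IsReferenceTime

end ReferenceTime

section ProductFamily

variable {F : ℕ → MarkovTriple.{u}} {p : ℕ → ℝ}

theorem partialSum_pos (hp : ∀ n, 0 < p n) (n : ℕ) : 0 < partialSum p n :=
  Finset.sum_pos (fun i _ => hp i) Finset.nonempty_range_add_one

theorem div_partialSum_nonneg (hp : ∀ n, 0 < p n) (n : ℕ) (i : Fin (n + 1)) :
    0 ≤ p i / partialSum p n :=
  (div_pos (hp i) (partialSum_pos hp n)).le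

theorem sum_div_partialSum (hp : ∀ n, 0 < p n) (n : ℕ) :
    ∑ i : Fin (n + 1), p i / partialSum p n = 1 := by
  rw [← Finset.sum_div, Fin.sum_univ_eq_sum_range]
  exact div_self (partialSum_pos hp n).ne'

theorem isStationaryChain_productFamily (hF : ∀ n, (F n).IsStationaryChain) (hp : ∀ n, 0 < p n)
    (n : ℕ) : (productFamily F p n).IsStationaryChain :=
  isStationaryChain_productChain (fun i => hF i) (div_partialSum_nonneg hp n)
    (sum_div_partialSum hp n)

variable {s : ℝ}

theorem maxDist_le_maxDist_productFamily (hF : ∀ n, (F n).IsStationaryChain)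
    (hp : ∀ n, 0 < p n) (δ : Distance) (n : ℕ) (hs : 0 ≤ s) :
    maxDist δ (F n) (p n * s) ≤ maxDist δ (productFamily F p n) (partialSum p n * s) := by
  have hq := partialSum_pos hp n
  have h := maxDist_le_maxDist_productChain (fun i : Fin (n + 1) => hF i)
    (div_partialSum_nonneg hp n) (sum_div_partialSum hp n) δ (mul_nonneg hq.le hs) (Fin.last n)
  rwa [← mul_assoc, div_mul_cancel₀ _ hq.ne'] at h

theorem prod_one_sub_le_one_sub_maxDist_productFamily (hF : ∀ n, (F n).IsStationaryChain)
    (hp : ∀ n, 0 < p n) (δ : Distance) (n : ℕ) (hs : 0 ≤ s) :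
    ∏ i ∈ Finset.range (n + 1), (1 - maxDist δ (F i) (p i * s) ^ δ.order) ≤
      1 - maxDist δ (productFamily F p n) (partialSum p n * s) ^ δ.order := by
  have hq := partialSum_pos hp n
  have h := prod_one_sub_le_one_sub_maxDist_productChain (fun i : Fin (n + 1) => hF i)
    (div_partialSum_nonneg hp n) (sum_div_partialSum hp n) δ (mul_nonneg hq.le hs)
  simp only [← mul_assoc, div_mul_cancel₀ _ hq.ne'] at h
  rwa [← Fin.prod_univ_eq_prod_range (fun i => 1 - maxDist δ (F i) (p i * s) ^ δ.order)]

theorem mul_prod_Ico_le_one_sub_maxDist_productFamily (hF : ∀ n, (F n).IsStationaryChain)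
    (hp : ∀ n, 0 < p n) (δ : Distance) {k n : ℕ} (hkn : k ≤ n + 1) (hs : 0 ≤ s) :
    (1 - ∑ i ∈ Finset.range k, maxDist δ (F i) (p i * s) ^ δ.order) *
        ∏ i ∈ Finset.Ico k (n + 1), (1 - maxDist δ (F i) (p i * s) ^ δ.order) ≤
      1 - maxDist δ (productFamily F p n) (partialSum p n * s) ^ δ.order := by
  have hmem (i : ℕ) : maxDist δ (F i) (p i * s) ^ δ.order ∈ Set.Icc 0 1 :=
    (hF i).maxDist_pow_mem_Icc (mul_nonneg (hp i).le hs) δ _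
  refine le_trans ?_ (prod_one_sub_le_one_sub_maxDist_productFamily hF hp δ n hs)
  rw [← Finset.prod_range_mul_prod_Ico _ hkn]
  exact mul_le_mul_of_nonneg_right (one_sub_sum_le_prod_one_sub _ hmem)
    (Finset.prod_nonneg fun i _ => sub_nonneg.2 (hmem i).2)

end ProductFamily

/-- The mixing behaviour under which a family of chains and its products, in which the `n`-th chain
runs at speed proportional to `p n`, share their cutoffs. On that common clock the mixing time of
the `n`-th chain is `S n`: its distance is bounded away from `0` before the time `p n * S n` and
away from `1` after it. Eventually `S n` is at least as large as its predecessors, and at any time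
`a * S n` with `a > c` all but boundedly many of the last chains contribute negligibly to the
distance of the product. -/
structure HasNegligiblePast (δ : Distance) (F : ℕ → MarkovTriple.{u}) (p S : ℕ → ℝ) (c : ℝ) :
    Prop where
  chain : ∀ n, (F n).IsStationaryChain
  c_pos : 0 < c
  c_lt_one : c < 1
  p_pos : ∀ n, 0 < p n
  pos : ∀ᶠ n in atTop, 0 < S n
  mono : ∀ᶠ n in atTop, ∀ i ≤ n, S i ≤ S n
  lower : ∃ e > 0, ∀ n t, 0 ≤ t → t < p n * S n → e ≤ maxDist δ (F n) t
  upper : ∃ e < 1, ∀ n t, 0 ≤ t → p n * S n < t → maxDist δ (F n) t ≤ e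
  tail : ∀ a, c < a → ∀ η > 0, ∃ m : ℕ, ∀ᶠ n in atTop,
    ∑ i ∈ Finset.range (n + 1 - m), maxDist δ (F i) (p i * (a * S n)) ^ δ.order ≤ η

namespace HasNegligiblePast

variable {δ : Distance} {F : ℕ → MarkovTriple.{u}} {p S : ℕ → ℝ} {a c : ℝ}

theorem maxDist_pow_mem_Icc (h : HasNegligiblePast δ F p S c) (ha : c < a) {n : ℕ} (hn : 0 < S n)
    (i : ℕ) : maxDist δ (F i) (p i * (a * S n)) ^ δ.order ∈ Set.Icc 0 1 :=
  (h.chain i).maxDist_pow_mem_Icc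
    (mul_pos (h.p_pos i) (mul_pos (h.c_pos.trans ha) hn)).le δ _

theorem comp (h : HasNegligiblePast δ F p S c) {ξ : ℕ → ℕ} (hξ : StrictMono ξ) :
    HasNegligiblePast δ (F ∘ ξ) (p ∘ ξ) (S ∘ ξ) c where
  chain n := h.chain _
  c_pos := h.c_pos
  c_lt_one := h.c_lt_one
  p_pos n := h.p_pos _
  pos := hξ.tendsto_atTop.eventually h.pos
  mono := (hξ.tendsto_atTop.eventually h.mono).mono fun n hn i hi => hn _ (hξ.monotone hi)
  lower := h.lower.imp fun e he => ⟨he.1, fun n => he.2 _⟩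
  upper := h.upper.imp fun e he => ⟨he.1, fun n => he.2 _⟩
  tail a ha η hη := by
    obtain ⟨m, hm⟩ := h.tail a ha η hη
    refine ⟨m, ?_⟩
    filter_upwards [hξ.tendsto_atTop.eventually hm, hξ.tendsto_atTop.eventually h.pos] with n hn hS
    refine le_trans (sum_range_comp_le_sum_range
      (fun i => (h.maxDist_pow_mem_Icc ha hS i).1) hξ fun i hi => ?_) hn
    have hgap : m + ξ i ≤ ξ n := (hξ.add_le_nat m i).trans (hξ.monotone (by omega))
    omega

theorem isReferenceTime (h : HasNegligiblePast δ F p S c) :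
    IsReferenceTime δ F (fun n => p n * S n) where
  chain := h.chain
  pos := h.pos.mono fun n hn => mul_pos (h.p_pos n) hn
  lower _ ha0 ha := h.lower.imp fun _ he => ⟨he.1, h.pos.mono fun n hn =>
    have hσ := mul_pos (h.p_pos n) hn
    he.2 n _ (mul_pos ha0 hσ).le (mul_lt_of_lt_one_left hσ ha)⟩
  upper _ ha := h.upper.imp fun _ he => ⟨he.1, h.pos.mono fun n hn =>
    have hσ := mul_pos (h.p_pos n) hn
    he.2 n _ (mul_pos (zero_lt_one.trans ha) hσ).le (lt_mul_of_one_lt_left hσ ha)⟩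

theorem maxDist_le_product (h : HasNegligiblePast δ F p S c) (ha : 0 < a) {n : ℕ} (hn : 0 < S n) :
    maxDist δ (F n) (a * (p n * S n)) ≤
      maxDist δ (productFamily F p n) (a * (partialSum p n * S n)) := by
  rw [mul_left_comm, mul_left_comm a]
  exact maxDist_le_maxDist_productFamily h.chain h.p_pos δ n (mul_pos ha hn).le

theorem eventually_pow_le_prod_Ico (h : HasNegligiblePast δ F p S c) (ha : c < a) (m : ℕ) {κ : ℝ}
    (hκ1 : κ ≤ 1) (hκ : ∀ᶠ i in atTop, maxDist δ (F i) (a * (p i * S i)) ^ δ.order ≤ κ) :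
    ∀ᶠ n in atTop, (1 - κ) ^ m ≤ ∏ i ∈ Finset.Ico (n + 1 - m) (n + 1),
      (1 - maxDist δ (F i) (p i * (a * S n)) ^ δ.order) := by
  have ha0 : 0 < a := h.c_pos.trans ha
  obtain ⟨N, hN⟩ := eventually_atTop.1 (hκ.and h.pos)
  filter_upwards [h.mono, eventually_ge_atTop (N + m)] with n hmono hn
  have hcard : (Finset.Ico (n + 1 - m) (n + 1)).card = m := by rw [Nat.card_Ico]; omega
  calc (1 - κ) ^ m = ∏ i ∈ Finset.Ico (n + 1 - m) (n + 1), (1 - κ) := by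
        rw [Finset.prod_const, hcard]
    _ ≤ _ := Finset.prod_le_prod (fun _ _ => sub_nonneg.2 hκ1) fun i hi => sub_le_sub_left ?_ 1
  rw [Finset.mem_Ico] at hi
  obtain ⟨hiκ, hSi⟩ := hN i (by omega)
  have htime : a * (p i * S i) ≤ p i * (a * S n) := by
    rw [mul_left_comm]
    gcongr
    exacts [(h.p_pos i).le, hmono i (by omega)]
  have hpos : 0 < a * (p i * S i) := mul_pos ha0 (mul_pos (h.p_pos i) hSi)
  exact le_trans (pow_le_pow_left₀ ((h.chain i).maxDist_nonneg (hpos.le.trans htime) δ)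
    ((h.chain i).maxDist_anti δ hpos.le htime) _) hiκ

theorem exists_eventually_mul_pow_le (h : HasNegligiblePast δ F p S c) (ha : c < a) {η : ℝ}
    (hη : 0 < η) (hη1 : η ≤ 1) : ∃ m : ℕ, ∀ κ : ℝ, κ ≤ 1 →
      (∀ᶠ i in atTop, maxDist δ (F i) (a * (p i * S i)) ^ δ.order ≤ κ) →
      ∀ᶠ n in atTop, (1 - η) * (1 - κ) ^ m ≤
        1 - maxDist δ (productFamily F p n) (a * (partialSum p n * S n)) ^ δ.order := by
  obtain ⟨m, hm⟩ := h.tail a ha η hη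
  refine ⟨m, fun κ hκ1 hκ => ?_⟩
  filter_upwards [hm, h.eventually_pow_le_prod_Ico ha m hκ1 hκ, h.pos] with n hpast hlast hS
  rw [mul_left_comm]
  refine le_trans ?_ (mul_prod_Ico_le_one_sub_maxDist_productFamily h.chain h.p_pos δ
    (Nat.sub_le (n + 1) m) (mul_pos (h.c_pos.trans ha) hS).le)
  have hpast' := sub_le_sub_left hpast 1
  exact mul_le_mul hpast' hlast (pow_nonneg (sub_nonneg.2 hκ1) m) ((sub_nonneg.2 hη1).trans hpast')

theorem isReferenceTime_product (h : HasNegligiblePast δ F p S c) :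
    IsReferenceTime δ (productFamily F p) (fun n => partialSum p n * S n) where
  chain := isStationaryChain_productFamily h.chain h.p_pos
  pos := h.pos.mono fun n hn => mul_pos (partialSum_pos h.p_pos n) hn
  lower a ha0 ha := by
    obtain ⟨e, he, hlow⟩ := h.isReferenceTime.lower a ha0 ha
    refine ⟨e, he, ?_⟩
    filter_upwards [hlow, h.pos] with n hn hS
    exact hn.trans (h.maxDist_le_product ha0 hS)
  upper a ha := by
    have ha0 : 0 < a := zero_lt_one.trans ha
    obtain ⟨e, he, hup⟩ := h.isReferenceTime.upper a ha
    obtain ⟨m, hm⟩ := h.exists_eventually_mul_pow_le (h.c_lt_one.trans ha) one_half_pos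
      one_half_lt_one.le
    have hpow : ∀ᶠ i in atTop, maxDist δ (F i) (a * (p i * S i)) ^ δ.order ≤ e := by
      filter_upwards [hup, h.isReferenceTime.eventually_maxDist_mem_Icc ha0] with i hi hmem
      exact (pow_le_of_le_one hmem.1 hmem.2 δ.order_ne_zero).trans hi
    have hk : (0 : ℝ) < δ.order := Nat.cast_pos.2 (Nat.pos_of_ne_zero δ.order_ne_zero)
    refine ⟨1 - (1 - 1 / 2) * (1 - e) ^ m / δ.order, sub_lt_self 1 <|
      div_pos (mul_pos (by norm_num) (pow_pos (sub_pos.2 he) m)) hk, ?_⟩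
    filter_upwards [hm e he.le hpow, h.pos] with n hn hS
    have hD := (isStationaryChain_productFamily h.chain h.p_pos n).maxDist_nonneg
      (mul_pos ha0 (mul_pos (partialSum_pos h.p_pos n) hS)).le δ
    rw [le_sub_comm, div_le_iff₀' hk]
    refine hn.trans ?_
    have hbernoulli := one_add_mul_sub_le_pow (n := δ.order) ((by norm_num : (-1 : ℝ) ≤ 0).trans hD)
    linarith

theorem tendsto_product_zero (h : HasNegligiblePast δ F p S c) (ha : c < a)
    (h0 : Tendsto (fun n => maxDist δ (F n) (a * (p n * S n))) atTop (𝓝 0)) :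
    Tendsto (fun n => maxDist δ (productFamily F p n) (a * (partialSum p n * S n)))
      atTop (𝓝 0) := by
  have ha0 : 0 < a := h.c_pos.trans ha
  have hpow := h0.pow δ.order
  rw [zero_pow δ.order_ne_zero] at hpow
  have hnn := h.pos.mono fun n hn =>
    (isStationaryChain_productFamily h.chain h.p_pos n).maxDist_nonneg
      (mul_pos ha0 (mul_pos (partialSum_pos h.p_pos n) hn)).le δ
  refine tendsto_order.2 ⟨fun b hb => hnn.mono fun n hn => hb.trans_le hn, fun ε hε => ?_⟩
  obtain ⟨η, hη, hη'⟩ := exists_between (lt_min (pow_pos hε δ.order) one_pos)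
  obtain ⟨m, hm⟩ := h.exists_eventually_mul_pow_le ha hη (hη'.le.trans (min_le_right _ _))
  have hκlim : Tendsto (fun κ : ℝ => 1 - (1 - η) * (1 - κ) ^ m) (𝓝[>] 0) (𝓝 η) := by
    refine tendsto_nhdsWithin_of_tendsto_nhds (Continuous.tendsto' (by fun_prop) _ _ ?_)
    simp
  obtain ⟨κ, hκε, hκ0, hκ1⟩ := ((hκlim.eventually_lt_const
    (hη'.trans_le (min_le_left _ _))).and (Ioo_mem_nhdsGT one_pos)).exists
  filter_upwards [hm κ hκ1.le ((hpow.eventually_lt_const hκ0).mono fun _ hi => hi.le)] with n hn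
  exact lt_of_pow_lt_pow_left₀ _ hε.le ((le_sub_comm.1 hn).trans_lt hκε)

theorem isCutoffTime_product (h : HasNegligiblePast δ F p S c) {t : ℕ → ℝ}
    (ht : IsCutoffTime δ F t) :
    IsCutoffTime δ (productFamily F p) (fun n => partialSum p n * t n / p n) := by
  have hP := isStationaryChain_productFamily h.chain h.p_pos
  have hq := partialSum_pos h.p_pos
  have htp (n : ℕ) : 0 < partialSum p n * t n / p n := div_pos (mul_pos (hq n) (ht.1 n)) (h.p_pos n)
  refine ⟨htp, fun a ha => ?_, fun a ha0 ha => ?_⟩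
  · have ha0 : 0 < a := zero_lt_one.trans ha
    obtain ⟨b, hb1, hba⟩ := exists_between ha
    have hb0 : 0 < b := zero_lt_one.trans hb1
    refine squeeze_zero' (Eventually.of_forall fun n =>
      (hP n).maxDist_nonneg (mul_pos ha0 (htp n)).le δ) ?_ <|
      h.tendsto_product_zero (h.c_lt_one.trans hb1) (h.isReferenceTime.tendsto_zero ⟨t, ht⟩ hb1)
    filter_upwards [h.isReferenceTime.eventually_le_mul ht ((one_lt_div hb0).2 hba), h.pos]
      with n hn hS
    refine (hP n).maxDist_anti δ (mul_pos hb0 (mul_pos (hq n) hS)).le ?_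
    have hb : b * S n ≤ a * t n / p n := by
      rw [le_div_iff₀ (h.p_pos n)]
      rw [div_mul_eq_mul_div, le_div_iff₀ hb0] at hn
      linarith
    calc b * (partialSum p n * S n) = partialSum p n * (b * S n) := mul_left_comm _ _ _
      _ ≤ partialSum p n * (a * t n / p n) := mul_le_mul_of_nonneg_left hb (hq n).le
      _ = a * (partialSum p n * t n / p n) := by ring
  · refine tendsto_of_tendsto_of_tendsto_of_le_of_le (ht.2.2 a ha0 ha) tendsto_const_nhds
      (fun n => ?_) fun n => ((hP n).maxDist_mem_Icc (mul_pos ha0 (htp n)).le δ).2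
    have hle := maxDist_le_maxDist_productFamily h.chain h.p_pos δ n
      (div_pos (mul_pos ha0 (ht.1 n)) (h.p_pos n)).le
    rw [mul_div_cancel₀ _ (h.p_pos n).ne'] at hle
    exact hle.trans_eq (congrArg _ (by ring))

theorem tendsto_zero_of_product (h : HasNegligiblePast δ F p S c)
    (hcut : HasCutoff δ (productFamily F p)) (ha : 1 < a) :
    Tendsto (fun n => maxDist δ (F n) (a * (p n * S n))) atTop (𝓝 0) := by
  have ha0 : 0 < a := zero_lt_one.trans ha
  exact squeeze_zero' ((h.isReferenceTime.eventually_maxDist_mem_Icc ha0).mono fun n hn => hn.1)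
    (h.pos.mono fun n hn => h.maxDist_le_product ha0 hn)
    (h.isReferenceTime_product.tendsto_zero hcut ha)

theorem tendsto_one_of_product (h : HasNegligiblePast δ F p S c)
    (hcut : HasCutoff δ (productFamily F p)) (ha : c < a) (ha1 : a < 1)
    (hsum : ∀ᶠ n in atTop,
      ∑ i ∈ Finset.range n, maxDist δ (F i) (p i * (a * S n)) ^ δ.order ≤ 1 / 2) :
    Tendsto (fun n => maxDist δ (F n) (a * (p n * S n))) atTop (𝓝 1) := by
  have ha0 : 0 < a := h.c_pos.trans ha
  have hlow : Tendsto (fun n => 1 - 2 * (1 - maxDist δ (productFamily F p n)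
      (a * (partialSum p n * S n)) ^ δ.order)) atTop (𝓝 1) := by
    simpa only [one_pow, sub_self, mul_zero, sub_zero] using
      ((((h.isReferenceTime_product.tendsto_one hcut ha0 ha1).pow δ.order).const_sub 1).const_mul
        2).const_sub 1
  have hmem := h.isReferenceTime.eventually_maxDist_mem_Icc ha0
  refine tendsto_of_tendsto_of_tendsto_of_le_of_le' hlow tendsto_const_nhds ?_
    (hmem.mono fun n hn => hn.2)
  filter_upwards [hsum, hmem, h.pos] with n hn hD hS
  have hprod := mul_prod_Ico_le_one_sub_maxDist_productFamily h.chain h.p_pos δ n.le_succ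
    (mul_pos ha0 hS).le
  rw [Nat.Ico_succ_singleton, Finset.prod_singleton, mul_left_comm, mul_left_comm _ a] at hprod
  have hhalf := mul_le_mul_of_nonneg_right (sub_le_sub_left hn 1)
    (sub_nonneg.2 (pow_le_one₀ (n := δ.order) hD.1 hD.2))
  have hpow := pow_le_of_le_one hD.1 hD.2 δ.order_ne_zero
  linarith

theorem exists_strictMono_eventually_sum_le (h : HasNegligiblePast δ F p S c) (ha : c < a) {η : ℝ}
    (hη : 0 < η) : ∃ ψ : ℕ → ℕ, StrictMono ψ ∧ ∀ᶠ n in atTop,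
      ∑ i ∈ Finset.range n, maxDist δ (F (ψ i)) (p (ψ i) * (a * S (ψ n))) ^ δ.order ≤ η := by
  obtain ⟨m, hm⟩ := h.tail a ha η hη
  have hψ : StrictMono fun j => (m + 1) * j := strictMono_mul_left_of_pos m.succ_pos
  refine ⟨_, hψ, ?_⟩
  filter_upwards [hψ.tendsto_atTop.eventually hm, hψ.tendsto_atTop.eventually h.pos] with n hn hS
  refine le_trans (sum_range_comp_le_sum_range
    (fun i => (h.maxDist_pow_mem_Icc ha hS i).1) hψ fun i hi => ?_) hn
  have hgap : (m + 1) * (i + 1) ≤ (m + 1) * n := Nat.mul_le_mul_left _ hi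
  rw [mul_add, mul_one] at hgap
  omega

theorem hasCutoff_of_product (h : HasNegligiblePast δ F p S c)
    (hcut : ∀ ξ : ℕ → ℕ, StrictMono ξ → HasCutoff δ (productFamily (F ∘ ξ) (p ∘ ξ))) :
    HasCutoff δ F := by
  refine .of_eventually_pos h.isReferenceTime.pos
    (fun a ha => h.tendsto_zero_of_product (hcut id strictMono_id) ha) fun a ha0 ha => ?_
  obtain ⟨b, hb, hb1⟩ := exists_between (max_lt h.c_lt_one ha)
  have hcb : c < b := (le_max_left _ _).trans_lt hb
  have hlim : Tendsto (fun n => maxDist δ (F n) (b * (p n * S n))) atTop (𝓝 1) := by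
    refine tendsto_of_subseq_tendsto fun ns hns => ?_
    obtain ⟨φ, -, hnφ⟩ := strictMono_subseq_of_tendsto_atTop hns
    obtain ⟨ψ, hψ, hsum⟩ := (h.comp hnφ).exists_strictMono_eventually_sum_le hcb one_half_pos
    exact ⟨φ ∘ ψ, ((h.comp hnφ).comp hψ).tendsto_one_of_product (hcut _ (hnφ.comp hψ)) hcb hb1 hsum⟩
  exact tendsto_of_tendsto_of_tendsto_of_le_of_le' hlim tendsto_const_nhds
    (h.isReferenceTime.pos.mono fun n hn => (h.chain n).maxDist_anti δ (mul_pos ha0 hn).le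
      (mul_le_mul_of_nonneg_right ((le_max_right _ _).trans hb.le) hn.le))
    ((h.isReferenceTime.eventually_maxDist_mem_Icc ha0).mono fun n hn => hn.2)

theorem frequently_lt_of_product (h : HasNegligiblePast δ F p S c)
    (hcut : HasCutoff δ (productFamily F p)) (ha : c < a) (ha1 : a < 1) {κ : ℝ} (hκ : κ < 1) :
    ∃ᶠ i in atTop, κ < maxDist δ (F i) (a * (p i * S i)) ^ δ.order := by
  intro hn
  simp only [not_lt] at hn
  obtain ⟨m, hm⟩ := h.exists_eventually_mul_pow_le ha one_half_pos one_half_lt_one.le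
  have hlim := (h.isReferenceTime_product.tendsto_one hcut (h.c_pos.trans ha) ha1).pow δ.order
  rw [one_pow] at hlim
  have hpos : 0 < (1 - 1 / 2 : ℝ) * (1 - κ) ^ m :=
    mul_pos (by norm_num) (pow_pos (sub_pos.2 hκ) m)
  obtain ⟨n, hle, hlt⟩ := ((hm κ hκ.le hn).and
    (hlim.eventually_const_lt (sub_lt_self 1 hpos))).exists
  linarith

theorem exists_subfamily_hasCutoff (h : HasNegligiblePast δ F p S c)
    (hcut : HasCutoff δ (productFamily F p)) :
    ∃ ξ : ℕ → ℕ, StrictMono ξ ∧ HasCutoff δ (F ∘ ξ) := by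
  obtain ⟨u, -, hu, hlim⟩ := exists_seq_strictMono_tendsto' h.c_lt_one
  obtain ⟨ξ, hξ, hlt⟩ := extraction_forall_of_frequently fun k =>
    h.frequently_lt_of_product hcut (hu k).1 (hu k).2 (hu k).2
  have hσ := (h.comp hξ).isReferenceTime
  refine ⟨ξ, hξ, .of_eventually_pos hσ.pos
    (fun a ha => (h.tendsto_zero_of_product hcut ha).comp hξ.tendsto_atTop) fun a ha0 ha => ?_⟩
  refine tendsto_of_tendsto_of_tendsto_of_le_of_le' hlim tendsto_const_nhds ?_
    ((hσ.eventually_maxDist_mem_Icc ha0).mono fun n hn => hn.2)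
  filter_upwards [hσ.pos, hlim.eventually_const_lt ha] with k hk hak
  have hmem := (hσ.chain k).maxDist_mem_Icc (mul_pos (ha0.trans hak) hk).le δ
  exact (hlt k).le.trans <| (pow_le_of_le_one hmem.1 hmem.2 δ.order_ne_zero).trans <|
    (hσ.chain k).maxDist_anti δ (mul_pos ha0 hk).le (mul_le_mul_of_nonneg_right hak.le hk.le)

end HasNegligiblePast

theorem Distance.one_le_rho (δ : Distance) : 1 ≤ δ.rho := by
  cases δ <;> simp [Distance.rho]

section MixingTime

variable {M : MarkovTriple.{u}} {δ : Distance} {ε t : ℝ}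

theorem maxDist_le_of_mixingTime_lt (h : M.IsStationaryChain)
    (hlt : mixingTime δ M ε < ENNReal.ofReal t) : maxDist δ M t ≤ ε := by
  simp only [mixingTime, iInf_lt_iff] at hlt
  obtain ⟨s, hs, hst⟩ := hlt
  have hst' := (ENNReal.lt_ofReal_iff_toReal_lt ENNReal.coe_ne_top).1 hst
  exact (h.maxDist_anti δ s.2 hst'.le).trans hs

theorem lt_maxDist_of_lt_mixingTime (ht : 0 ≤ t) (hlt : ENNReal.ofReal t < mixingTime δ M ε) :
    ε < maxDist δ M t := by
  by_contra! hle
  exact hlt.not_ge <|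
    (iInf₂_le (⟨t, ht⟩ : ℝ≥0) hle).trans_eq (ENNReal.ofReal_eq_coe_nnreal ht).symm

variable {τ e : ℝ}

theorem maxDist_le_pow (h : M.IsStationaryChain) (hτ : 0 ≤ τ)
    (hle : ∀ s, τ < s → maxDist δ M s ≤ e) {k : ℕ} (hk : k ≠ 0) (hkt : k * τ < t) :
    maxDist δ M t ≤ (2 * δ.rho * e) ^ k := by
  obtain ⟨k, rfl⟩ := Nat.exists_eq_succ_of_ne_zero hk
  have hk0 : (0 : ℝ) < (k + 1 : ℕ) := Nat.cast_pos.2 k.succ_pos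
  have hlt : τ < t / (k + 1 : ℕ) := by rwa [lt_div_iff₀' hk0]
  have ht : 0 ≤ t / (k + 1 : ℕ) := hτ.trans hlt.le
  have hρ := δ.one_le_rho
  calc maxDist δ M t ≤ 2 * δ.rho * maxDist δ M t := by
        linarith [mul_nonneg (by linarith : 0 ≤ 2 * δ.rho - 1)
          (h.maxDist_nonneg ((mul_nonneg hk0.le hτ).trans hkt.le) δ)]
    _ = 2 * δ.rho * maxDist δ M ((k + 1 : ℕ) * (t / (k + 1 : ℕ))) := by
        rw [mul_div_cancel₀ _ hk0.ne']
    _ ≤ (2 * δ.rho * maxDist δ M (t / (k + 1 : ℕ))) ^ (k + 1) := h.maxDist_succ_mul_le δ ht k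
    _ ≤ (2 * δ.rho * e) ^ (k + 1) := pow_le_pow_left₀
        (mul_nonneg (by linarith) (h.maxDist_nonneg ht δ))
        (mul_le_mul_of_nonneg_left (hle _ hlt) (by linarith)) _

theorem maxDist_eq_zero (h : M.IsStationaryChain) (he : 0 ≤ e) (he1 : 2 * δ.rho * e < 1)
    (hle : ∀ s, 0 < s → maxDist δ M s ≤ e) (ht : 0 < t) : maxDist δ M t = 0 := by
  have hρ := δ.one_le_rho
  refine le_antisymm ?_ (h.maxDist_nonneg ht.le δ)
  refine ge_of_tendsto (tendsto_pow_atTop_nhds_zero_of_lt_one (by positivity) he1) ?_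
  filter_upwards [eventually_ne_atTop 0] with k hk
  exact maxDist_le_pow h le_rfl hle hk (by rwa [mul_zero])

variable {a c s : ℝ}

/- With `k` the last integer before `a * (s / τ)`, the distance is at most `(2ρe) ^ k`, and the
assumption on `s / τ` lets the factor `c < a` absorb the rounding. -/
theorem maxDist_pow_le_rpow (h : M.IsStationaryChain) (he : 0 < e) (he1 : 2 * δ.rho * e < 1)
    (hτ : 0 < τ) (hle : ∀ s, τ < s → maxDist δ M s ≤ e) (hc : 0 < c) (hca : c < a)
    (hs : 2 / (a - c) ≤ s / τ) :
    maxDist δ M (a * s) ^ δ.order ≤ (2 * δ.rho * e) ^ (c * δ.rho * (s / τ)) := by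
  have hρ := δ.one_le_rho
  have hac : 0 < a - c := sub_pos.2 hca
  have hx0 : 0 < s / τ := (by positivity : 0 < 2 / (a - c)).trans_le hs
  have has : a * s = a * (s / τ) * τ := by rw [mul_assoc, div_mul_cancel₀ _ hτ.ne']
  rw [div_le_iff₀ hac] at hs
  have hax : 2 ≤ a * (s / τ) := by nlinarith
  set k := ⌈a * (s / τ)⌉₊ - 1
  have hceil : 2 ≤ ⌈a * (s / τ)⌉₊ := by exact_mod_cast hax.trans (Nat.le_ceil _)
  have hle_k : a * (s / τ) ≤ k + 1 := (Nat.le_ceil _).trans (by norm_cast; omega)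
  have hk_lt : (k : ℝ) < a * (s / τ) := Nat.lt_ceil.1 (by omega)
  calc maxDist δ M (a * s) ^ δ.order ≤ ((2 * δ.rho * e) ^ k) ^ δ.order := by
        rw [has]
        exact pow_le_pow_left₀ (h.maxDist_nonneg (mul_nonneg (by linarith) hτ.le) δ)
          (maxDist_le_pow h hτ.le hle (by omega) (mul_lt_mul_of_pos_right hk_lt hτ)) _
    _ = (2 * δ.rho * e) ^ ((k * δ.order : ℕ) : ℝ) := by rw [Real.rpow_natCast, pow_mul]
    _ ≤ (2 * δ.rho * e) ^ (c * δ.rho * (s / τ)) := by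
        refine Real.rpow_le_rpow_of_exponent_ge (by positivity) he1.le ?_
        rw [Nat.cast_mul, ← δ.rho_eq, mul_right_comm]
        exact mul_le_mul_of_nonneg_right (by nlinarith) (by linarith)

end MixingTime

section PowInf

variable {b x : ℝ}

theorem powInf_zero (b : ℝ) : powInf b 0 = 1 := by simp [powInf]

theorem powInf_ofReal (hx : 0 ≤ x) : powInf b (ENNReal.ofReal x) = ENNReal.ofReal (b ^ x) := by
  simp [powInf, ENNReal.toReal_ofReal hx]

theorem ofReal_maxDist_pow_le_powInf {M : MarkovTriple.{u}} {δ : Distance} {τ : ℝ≥0∞} {a c e s : ℝ}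
    (h : M.IsStationaryChain) (he : 0 < e) (he1 : 2 * δ.rho * e < 1) (hτ : τ ≠ ∞)
    (hle : ∀ s, τ.toReal < s → maxDist δ M s ≤ e) (hc : 0 < c) (hca : c < a) (hs : 0 < s)
    (hlt : powInf (2 * δ.rho * e) (ENNReal.ofReal (c * δ.rho) * (ENNReal.ofReal s / τ)) <
      ENNReal.ofReal ((2 * δ.rho * e) ^ (c * δ.rho * (2 / (a - c))))) :
    ENNReal.ofReal (maxDist δ M (a * s) ^ δ.order) ≤
      powInf (2 * δ.rho * e) (ENNReal.ofReal (c * δ.rho) * (ENNReal.ofReal s / τ)) := by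
  have hκ : 0 < c * δ.rho := mul_pos hc (zero_lt_one.trans_le δ.one_le_rho)
  have hb : 0 < 2 * δ.rho * e := by have := δ.one_le_rho; positivity
  rcases eq_or_ne τ 0 with rfl | hτ0
  · rw [maxDist_eq_zero h he.le he1 (by simpa using hle) (mul_pos (hc.trans hca) hs),
      zero_pow δ.order_ne_zero, ENNReal.ofReal_zero]
    exact zero_le
  · have hτ' : 0 < τ.toReal := ENNReal.toReal_pos hτ0 hτ
    have hexp : ENNReal.ofReal (c * δ.rho) * (ENNReal.ofReal s / τ) =
        ENNReal.ofReal (c * δ.rho * (s / τ.toReal)) := by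
      rw [ENNReal.ofReal_mul hκ.le, ENNReal.ofReal_div_of_pos hτ', ENNReal.ofReal_toReal hτ]
    rw [hexp, powInf_ofReal (by positivity)] at hlt ⊢
    rw [ENNReal.ofReal_lt_ofReal_iff_of_nonneg (Real.rpow_nonneg hb.le _),
      Real.rpow_lt_rpow_left_iff_of_base_lt_one hb he1, mul_lt_mul_iff_right₀ hκ] at hlt
    exact ENNReal.ofReal_le_ofReal (maxDist_pow_le_rpow h he he1 hτ' hle hc hca hlt.le)

end PowInf

section TailCondition

/-- The exponent `κ T_n p_i / (T_i p_n)` of the summation condition, in `[0, ∞]`. -/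
noncomputable def tailExponent (κ : ℝ) (T : ℕ → ℝ≥0∞) (p : ℕ → ℝ) (i n : ℕ) : ℝ≥0∞ :=
  ENNReal.ofReal κ * ((T n * ENNReal.ofReal (p i)) / (T i * ENNReal.ofReal (p n)))

/-- The summation condition `lim_m limsup_n ∑_{i ≤ n - m} b ^ (κ T_n p_i / (T_i p_n)) = 0`. -/
def TailCondition (b κ : ℝ) (T : ℕ → ℝ≥0∞) (p : ℕ → ℝ) : Prop :=
  Tendsto (fun m : ℕ => limsup (fun n : ℕ =>
    ∑ i ∈ Finset.range (n + 1 - m), powInf b (tailExponent κ T p i n)) atTop) atTop (𝓝 0)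

variable {b κ : ℝ} {T : ℕ → ℝ≥0∞} {p : ℕ → ℝ}

theorem tailExponent_of_eq_top (hp : ∀ n, 0 < p n) {i n : ℕ} (hi : T i = ∞) :
    tailExponent κ T p i n = 0 := by
  rw [tailExponent, hi, ENNReal.top_mul (ENNReal.ofReal_pos.2 (hp n)).ne', ENNReal.div_top,
    mul_zero]

theorem tailExponent_of_eq_zero {i n : ℕ} (hn : T n = 0) : tailExponent κ T p i n = 0 := by
  rw [tailExponent, hn, zero_mul, ENNReal.zero_div, mul_zero]

theorem tailExponent_eq (hp : ∀ n, 0 < p n) {i n : ℕ} (hn : T n ≠ ∞) :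
    tailExponent κ T p i n =
      ENNReal.ofReal κ * (ENNReal.ofReal (p i * ((T n).toReal / p n)) / T i) := by
  have hinv : (T i * ENNReal.ofReal (p n))⁻¹ = (T i)⁻¹ * (ENNReal.ofReal (p n))⁻¹ :=
    ENNReal.mul_inv (Or.inr ENNReal.ofReal_ne_top) (Or.inr (ENNReal.ofReal_pos.2 (hp n)).ne')
  rw [tailExponent, ENNReal.ofReal_mul (hp i).le, ENNReal.ofReal_div_of_pos (hp n),
    ENNReal.ofReal_toReal hn]
  simp only [div_eq_mul_inv, hinv]
  ring

namespace TailCondition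

theorem exists_eventually_sum_lt (h : TailCondition b κ T p) {η : ℝ≥0∞} (hη : 0 < η) :
    ∃ m : ℕ, ∀ᶠ n in atTop,
      ∑ i ∈ Finset.range (n + 1 - m), powInf b (tailExponent κ T p i n) < η := by
  obtain ⟨m, hm⟩ := (h.eventually_lt_const hη).exists
  exact ⟨m, eventually_lt_of_limsup_lt hm⟩

theorem exists_eventually_tailExponent_ne_zero (h : TailCondition b κ T p) :
    ∃ m : ℕ, ∀ᶠ n in atTop, ∀ i, i + m ≤ n → tailExponent κ T p i n ≠ 0 := by
  obtain ⟨m, hm⟩ := h.exists_eventually_sum_lt one_pos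
  refine ⟨m, hm.mono fun n hn i hi h0 => hn.not_ge ?_⟩
  rw [← powInf_zero b, ← h0]
  exact Finset.single_le_sum (f := fun i => powInf b (tailExponent κ T p i n))
    (fun _ _ => zero_le) (Finset.mem_range.2 (by omega))

theorem ne_top (h : TailCondition b κ T p) (hp : ∀ n, 0 < p n) {N : ℕ}
    (hmax : ∀ n, N ≤ n → ∀ i ≤ n, T i / ENNReal.ofReal (p i) ≤ T n / ENNReal.ofReal (p n))
    (j : ℕ) : T j ≠ ∞ := by
  intro hj
  obtain ⟨m, hm⟩ := h.exists_eventually_tailExponent_ne_zero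
  obtain ⟨n, hn, hn'⟩ := (hm.and (eventually_ge_atTop (max N j + m))).exists
  refine hn (max N j) hn' (tailExponent_of_eq_top hp ?_)
  have hle := hmax (max N j) (le_max_left _ _) j (le_max_right _ _)
  rw [hj, ENNReal.top_div_of_ne_top ENNReal.ofReal_ne_top, top_le_iff] at hle
  by_contra hne
  exact ENNReal.div_ne_top hne (ENNReal.ofReal_pos.2 (hp _)).ne' hle

theorem eventually_ne_zero (h : TailCondition b κ T p) : ∀ᶠ n in atTop, T n ≠ 0 := by
  obtain ⟨m, hm⟩ := h.exists_eventually_tailExponent_ne_zero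
  filter_upwards [hm, eventually_ge_atTop m] with n hn hmn h0
  exact hn 0 (by omega) (tailExponent_of_eq_zero h0)

theorem exists_eventually_sum_maxDist_le {δ : Distance} {F : ℕ → MarkovTriple.{u}} {a c e : ℝ}
    (h : TailCondition (2 * δ.rho * e) (c * δ.rho) T p) (hF : ∀ n, (F n).IsStationaryChain)
    (hp : ∀ n, 0 < p n) (he : 0 < e) (he1 : 2 * δ.rho * e < 1) (hT : ∀ n, T n ≠ ∞)
    (hle : ∀ n t, (T n).toReal < t → maxDist δ (F n) t ≤ e) (hc : 0 < c) (hca : c < a) {η : ℝ}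
    (hη : 0 < η) : ∃ m : ℕ, ∀ᶠ n in atTop, ∑ i ∈ Finset.range (n + 1 - m),
      maxDist δ (F i) (p i * (a * ((T n).toReal / p n))) ^ δ.order ≤ η := by
  have hb : 0 < 2 * δ.rho * e := by have := δ.one_le_rho; positivity
  have hr := Real.rpow_pos_of_pos hb (c * δ.rho * (2 / (a - c)))
  obtain ⟨m, hm⟩ := h.exists_eventually_sum_lt (ENNReal.ofReal_pos.2 (lt_min hη hr))
  refine ⟨m, ?_⟩
  filter_upwards [hm, h.eventually_ne_zero] with n hn hTn
  have hS : 0 < (T n).toReal / p n := div_pos (ENNReal.toReal_pos hTn (hT n)) (hp n)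
  have hterm : ∀ i ∈ Finset.range (n + 1 - m),
      ENNReal.ofReal (maxDist δ (F i) (p i * (a * ((T n).toReal / p n))) ^ δ.order) ≤
        powInf (2 * δ.rho * e) (tailExponent (c * δ.rho) T p i n) := fun i hi => by
    have hlt := ((Finset.single_le_sum (fun _ _ => zero_le) hi).trans_lt hn).trans_le
      (ENNReal.ofReal_le_ofReal (min_le_right _ _))
    rw [tailExponent_eq hp (hT n)] at hlt ⊢
    rw [mul_left_comm]
    exact ofReal_maxDist_pow_le_powInf (hF i) he he1 (hT i) (hle i) hc hca (mul_pos (hp i) hS) hlt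
  have hsum := (Finset.sum_le_sum hterm).trans hn.le
  rw [← ENNReal.ofReal_sum_of_nonneg fun i _ => ((hF i).maxDist_pow_mem_Icc
    (mul_pos (hp i) (mul_pos (hc.trans hca) hS)).le δ _).1,
    ENNReal.ofReal_le_ofReal_iff (lt_min hη hr).le] at hsum
  exact hsum.trans (min_le_left _ _)

end TailCondition

theorem hasNegligiblePast_mixingTime {δ : Distance} {F : ℕ → MarkovTriple.{u}}
    (hF : ∀ n, (F n).IsStationaryChain) (hp : ∀ n, 0 < p n) {c : ℝ} (hc : 0 < c) (hc1 : c < 1)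
    {N : ℕ} {ε : ℕ → ℝ} {e₀ e₁ : ℝ} (he₀ : 0 < e₀) (hε₀ : ∀ n, e₀ ≤ ε n) (hε₁ : ∀ n, ε n ≤ e₁)
    (he₁ : 2 * δ.rho * e₁ < 1)
    (hmax : ∀ n, N ≤ n → ∀ i ≤ n, mixingTime δ (F i) (ε i) / ENNReal.ofReal (p i) ≤
      mixingTime δ (F n) (ε n) / ENNReal.ofReal (p n))
    (htail : TailCondition (2 * δ.rho * e₁) (c * δ.rho) (fun n => mixingTime δ (F n) (ε n)) p) :
    HasNegligiblePast δ F p (fun n => (mixingTime δ (F n) (ε n)).toReal / p n) c := by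
  have hfin := htail.ne_top hp hmax
  have hpS (n : ℕ) : p n * ((mixingTime δ (F n) (ε n)).toReal / p n) =
      (mixingTime δ (F n) (ε n)).toReal := mul_div_cancel₀ _ (hp n).ne'
  have he₁0 : 0 < e₁ := he₀.trans_le ((hε₀ 0).trans (hε₁ 0))
  have hupper (n : ℕ) (t : ℝ) (ht : (mixingTime δ (F n) (ε n)).toReal < t) :
      maxDist δ (F n) t ≤ e₁ :=
    (maxDist_le_of_mixingTime_lt (hF n) ((ENNReal.lt_ofReal_iff_toReal_lt (hfin n)).2 ht)).trans
      (hε₁ n)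
  refine ⟨hF, hc, hc1, hp, htail.eventually_ne_zero.mono fun n hn =>
    div_pos (ENNReal.toReal_pos hn (hfin n)) (hp n), ?_, ⟨e₀, he₀, fun n t ht0 ht => ?_⟩,
    ⟨e₁, by nlinarith [δ.one_le_rho], fun n t _ ht => hupper n t (hpS n ▸ ht)⟩,
    fun a ha η hη => htail.exists_eventually_sum_maxDist_le hF hp he₁0 he₁ hfin hupper hc ha hη⟩
  · filter_upwards [eventually_ge_atTop N] with n hn i hi
    have hle := ENNReal.toReal_mono
      (ENNReal.div_ne_top (hfin n) (ENNReal.ofReal_pos.2 (hp n)).ne') (hmax n hn i hi)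
    rwa [ENNReal.toReal_div, ENNReal.toReal_div, ENNReal.toReal_ofReal (hp _).le,
      ENNReal.toReal_ofReal (hp _).le] at hle
  · exact (hε₀ n).trans (lt_maxDist_of_lt_mixingTime ht0
      ((ENNReal.ofReal_lt_iff_lt_toReal ht0 (hfin n)).2 (hpS n ▸ ht))).le

end TailCondition

end ProductCutoff

theorem theorem4p7_general (δ : Distance)
    (F : ℕ → MarkovTriple.{u}) (hF : ∀ n, (F n).IsStationaryChain)
    (p : ℕ → ℝ) (hp : ∀ n, 0 < p n)
    (c₀ : ℝ) (hc₀ : 0 < c₀) (hc₀' : c₀ < 1) (N : ℕ)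
    (ε : ℕ → ℝ) (hε_inf : 0 < ⨅ n, ε n) (hε_bdd : BddAbove (Set.range ε))
    (hε_sup : ⨆ n, ε n < 1 / (2 * δ.rho))
    (hmax : ∀ n, N ≤ n →
      (Finset.range (n + 1)).sup
          (fun i => mixingTime δ (F i) (ε i) / ENNReal.ofReal (p i)) =
        mixingTime δ (F n) (ε n) / ENNReal.ofReal (p n))
    (hsum : Tendsto
      (fun m : ℕ => limsup
        (fun n : ℕ => ∑ i ∈ Finset.range (n + 1 - m),
          powInf (2 * δ.rho * ⨆ k, ε k)
            (ENNReal.ofReal (c₀ * δ.rho) *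
              ((mixingTime δ (F n) (ε n) * ENNReal.ofReal (p i)) /
                (mixingTime δ (F i) (ε i) * ENNReal.ofReal (p n)))))
        atTop)
      atTop (𝓝 0)) :
    (HasCutoff δ F ↔
      ∀ ξ : ℕ → ℕ, StrictMono ξ → HasCutoff δ (productFamily (F ∘ ξ) (p ∘ ξ))) ∧
    (HasCutoff δ F → HasCutoff δ (productFamily F p)) ∧
    ((∀ ξ : ℕ → ℕ, StrictMono ξ → ¬ HasCutoff δ (F ∘ ξ)) ↔
      ∀ ξ : ℕ → ℕ, StrictMono ξ → ¬ HasCutoff δ (productFamily (F ∘ ξ) (p ∘ ξ))) ∧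
    ((∀ ξ : ℕ → ℕ, StrictMono ξ → ¬ HasCutoff δ (F ∘ ξ)) →
      ¬ HasCutoff δ (productFamily F p)) ∧
    (∀ t : ℕ → ℝ, IsCutoffTime δ F t →
      IsCutoffTime δ (productFamily F p) (fun n => partialSum p n * t n / p n)) := by
  have hbdd : BddBelow (Set.range ε) := by
    by_contra hc
    exact hε_inf.ne' (Real.iInf_of_not_bddBelow hc)
  have hρ : 0 < 2 * δ.rho := by linarith [δ.one_le_rho]
  have h := hasNegligiblePast_mixingTime hF hp hc₀ hc₀' hε_inf (ciInf_le hbdd) (le_ciSup hε_bdd)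
    (by rwa [lt_div_iff₀ hρ, mul_comm] at hε_sup)
    (fun n hn i hi => (Finset.le_sup
      (f := fun i => mixingTime δ (F i) (ε i) / ENNReal.ofReal (p i))
      (Finset.mem_range.2 (Nat.lt_succ_of_le hi))).trans_eq (hmax n hn)) hsum
  refine ⟨⟨?_, h.hasCutoff_of_product⟩, ?_, ⟨?_, ?_⟩, ?_, fun t ht => h.isCutoffTime_product ht⟩
  · rintro ⟨t, ht⟩ ξ hξ
    exact ⟨_, (h.comp hξ).isCutoffTime_product (ht.comp hξ)⟩
  · rintro ⟨t, ht⟩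
    exact ⟨_, h.isCutoffTime_product ht⟩
  · intro hno ξ hξ hcut
    obtain ⟨ζ, hζ, hcutζ⟩ := (h.comp hξ).exists_subfamily_hasCutoff hcut
    exact hno (ξ ∘ ζ) (hξ.comp hζ) hcutζ
  · rintro hno ξ hξ ⟨t, ht⟩
    exact hno ξ hξ ⟨_, (h.comp hξ).isCutoffTime_product ht⟩
  · intro hno hcut
    obtain ⟨ξ, hξ, hcutξ⟩ := h.exists_subfamily_hasCutoff hcut
    exact hno ξ hξ hcutξ

theorem theorem4p7 (δ : Distance)
    (F : ℕ → MarkovTriple.{u}) (hF : ∀ n, (F n).IsIrreducibleChain)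
    (p : ℕ → ℝ) (hp : ∀ n, 0 < p n)
    (c₀ : ℝ) (hc₀ : 0 < c₀) (hc₀' : c₀ < 1) (N : ℕ)
    (ε : ℕ → ℝ) (hε_inf : 0 < ⨅ n, ε n) (hε_bdd : BddAbove (Set.range ε))
    (hε_sup : ⨆ n, ε n < 1 / (2 * δ.rho))
    (hmax : ∀ n, N ≤ n →
      (Finset.range (n + 1)).sup
          (fun i => mixingTime δ (F i) (ε i) / ENNReal.ofReal (p i)) =
        mixingTime δ (F n) (ε n) / ENNReal.ofReal (p n))
    (hsum : Tendsto
      (fun m : ℕ => limsup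
        (fun n : ℕ => ∑ i ∈ Finset.range (n + 1 - m),
          powInf (2 * δ.rho * ⨆ k, ε k)
            (ENNReal.ofReal (c₀ * δ.rho) *
              ((mixingTime δ (F n) (ε n) * ENNReal.ofReal (p i)) /
                (mixingTime δ (F i) (ε i) * ENNReal.ofReal (p n)))))
        atTop)
      atTop (𝓝 0)) :
    (HasCutoff δ F ↔
      ∀ ξ : ℕ → ℕ, StrictMono ξ → HasCutoff δ (productFamily (F ∘ ξ) (p ∘ ξ))) ∧
    (HasCutoff δ F → HasCutoff δ (productFamily F p)) ∧
    ((∀ ξ : ℕ → ℕ, StrictMono ξ → ¬ HasCutoff δ (F ∘ ξ)) ↔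
      ∀ ξ : ℕ → ℕ, StrictMono ξ → ¬ HasCutoff δ (productFamily (F ∘ ξ) (p ∘ ξ))) ∧
    ((∀ ξ : ℕ → ℕ, StrictMono ξ → ¬ HasCutoff δ (F ∘ ξ)) →
      ¬ HasCutoff δ (productFamily F p)) ∧
    (∀ t : ℕ → ℝ, IsCutoffTime δ F t →
      IsCutoffTime δ (productFamily F p) (fun n => partialSum p n * t n / p n)) :=
  theorem4p7_general δ F (fun n => (hF n).isStationaryChain) p hp c₀ hc₀ hc₀' N ε hε_inf hε_bdd
    hε_sup hmax hsum
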